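/- For $n\in\mathbb N$ and $p\in[0,1]$ let $G(n,p)$ be the random graph on $n$ labelled vertices in which each pair is an edge independently with probability $p$, and let $\mathrm{Diam}(G)$ be the largest distance between two vertices of $G$ (with $\mathrm{Diam}(G)=\infty$ if $G$ is disconnected). Let $S$ be an infinite set of positive integers (for instance the set of all of them). All asymptotic notation refers to $n\to\infty$ with $n\in S$, and an event holds w.h.p. if its probability tends to $1$ in this sense. Let $c>1$ be a constant, let $d=d(n)$ satisfy $c\log n\le d(n)\le n$ for $n\in S$, and put $p=d/n$. Suppose that $t^*=t^*(n)$ is the largest non-negative integer sequence with $d^{t^*}=o(n)$; that is, $d^{t^*}=o(n)$, and every sequence $s=s(n)$ of non-negative integers with $d^{s}=o(n)$ satisfies $s(n)\le t^*(n)$ for all sufficiently large $n\in S$. Let $\gamma=\gamma(n)=p\,d^{t^*}=d^{t^*+1}/n$. Then, for $G=G(n,p)$: * w.h.p. $\mathrm{Diam}(G)\ge t^*$; * (Case 1) if $\gamma=O(1)$, then w.h.p. $\mathrm{Diam}(G)\le t^*+3$; * (Case 2) if $\gamma=\omega(1)$, i.e. $\gamma(n)\to\infty$, then w.h.p. $\mathrm{Diam}(G)\le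 t^*+2$. Consequently, in either case, w.h.p. $\mathrm{Diam}(G)\in\{t^*,t^*+1,t^*+2,t^*+3\}$. -/

import Mathlib

open Filter Topology Asymptotics MeasureTheory

/-- The filter of `n → ∞` with `n` ranging over `S`. For `S = Set.univ` this is `atTop`. -/
def nToInfinityIn (S : Set ℕ) : Filter ℕ := atTop ⊓ 𝓟 S

/-- `t = t(n)` is the largest integer (sequence) such that `d ^ t = o(n)`: it has this property,
and every `s = s(n)` with `d ^ s = o(n)` satisfies `s(n) ≤ t(n)` for all large `n`. -/
structure IsTStar (l : Filter ℕ) (d : ℕ → ℝ) (t : ℕ → ℕ) : Prop where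
  isLittleO : (fun n => d n ^ t n) =o[l] (fun n => (n : ℝ))
  largest : ∀ s : ℕ → ℕ, (fun n => d n ^ s n) =o[l] (fun n => (n : ℝ)) → ∀ᶠ n in l, s n ≤ t n

/-- `γ(n) = p d ^ t* = d ^ (t* + 1) / n`. -/
noncomputable def gammaOf (d : ℕ → ℝ) (t : ℕ → ℕ) (n : ℕ) : ℝ := d n ^ (t n + 1) / n

/-- Case 1: `γ = O(1)`. -/
def CaseOne (l : Filter ℕ) (d : ℕ → ℝ) (t : ℕ → ℕ) : Prop :=
  gammaOf d t =O[l] (fun _ => (1 : ℝ))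

/-- Case 2: `γ = ω(1)`. -/
def CaseTwo (l : Filter ℕ) (d : ℕ → ℝ) (t : ℕ → ℕ) : Prop :=
  Tendsto (gammaOf d t) l atTop

/-- The graph property `E n` holds with high probability for the binomial random graph
`G(n, p(n))` on the vertex set `Fin n`. -/
def HoldsWhp (l : Filter ℕ) (p : ℕ → unitInterval)
    (E : (n : ℕ) → SimpleGraph (Fin n) → Prop) : Prop :=
  Tendsto (fun n => SimpleGraph.binomialRandom (Fin n) (p n) {G | E n G}) l (𝓝 1)

/-! Lower bound: a first-moment computation. For two fixed vertices the expected number of paths of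
length at most `t* - 1` is at most `p * (1 + d + ... + d ^ (t* - 2))`, a geometric sum dominated by
`p * d ^ (t* - 1) = d ^ t* / n`, which tends to 0 (`binomialRandom_edist_le`, `holdsWhp_le_ediam`).

Upper bound: a search from one end of each pair, followed by a union bound. Since `d ≥ c log n` with
`c > 1`, the exponential moment bound shows that w.h.p. all degrees are at least `δ d + 1` for some
constant `δ > 0`. Given a pair `u, v`, fix disjoint sets `S`, `T` of about `δ d` neighbours of each;
if the neighbourhoods meet, the distance is at most 2 already. The pairs not touching `u` or `v` are
independent of this choice. Growing layers from `S` inside unexplored vertices multiplies the size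
by nearly `d` each time, until a layer of order `d ^ t*` is reached; this works because `d ^ t* =
o(n)` keeps overlaps negligible (`binomialRandom_not_joins_layers`).

If `γ → ∞`, that layer and `T` have about `p * d ^ t* * d = d γ`, hence many times `log n`, expected
edges between them, so some edge exists and the distance is at most `t* + 2`. If `γ = O(1)`, one
more layer is grown, to a small constant times `d ^ (t* + 1)`, and the expected number of edges to
`T` is of order `d ^ 2 γ`. Maximality of `t*` bounds `γ` away from 0 (`IsTStar.exists_le_gammaOf`),
so this again beats `log n`, at the price of one more step.

All estimates are tuned so that a pair fails with probability at most `(t* + 2) * n ^ (-4)`, which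
survives the union over `n ^ 2` pairs. Independence throughout is that of events read off disjoint
sets of pairs (`binomialRandom_inter`). -/

namespace BinomialRandomGraph

open ProbabilityTheory SimpleGraph

/-! ### Independence of events on disjoint sets of pairs -/

section

variable {V : Type*} {p : unitInterval}

/-- The event `A` only depends on which of the pairs in `F` are edges. -/
def DeterminedBy (F : Set (Sym2 V)) (A : Set (SimpleGraph V)) : Prop :=
  ∀ G G' : SimpleGraph V, (∀ e ∈ F, e ∈ G.edgeSet ↔ e ∈ G'.edgeSet) → (G ∈ A ↔ G' ∈ A)

lemma DeterminedBy.mono {F F' : Set (Sym2 V)} {A : Set (SimpleGraph V)}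
    (h : DeterminedBy F A) (hF : F ⊆ F') : DeterminedBy F' A :=
  fun G G' hG => h G G' fun e he => hG e (hF he)

lemma DeterminedBy.inter {F : Set (Sym2 V)} {A B : Set (SimpleGraph V)}
    (hA : DeterminedBy F A) (hB : DeterminedBy F B) : DeterminedBy F (A ∩ B) :=
  fun G G' hG => and_congr (hA G G' hG) (hB G G' hG)

lemma determinedBy_adj (u v : V) : DeterminedBy {s(u, v)} {G | G.Adj u v} :=
  fun G G' h => by simpa using h s(u, v)

lemma DeterminedBy.compl {F : Set (Sym2 V)} {A : Set (SimpleGraph V)}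
    (hA : DeterminedBy F A) : DeterminedBy F Aᶜ :=
  fun G G' hG => not_congr (hA G G' hG)

/-- The graph with edges the non-diagonal pairs satisfying `ω`. -/
def graphOf (ω : Sym2 V → Prop) : SimpleGraph V := fromEdgeSet {e | ω e}

variable [Fintype V]

/-- Every set of graphs on a finite vertex type is measurable. -/
instance instDiscreteMeasurableSpaceSimpleGraph : DiscreteMeasurableSpace (SimpleGraph V) where
  forall_measurableSet A := by
    have h : A = edgeSet ⁻¹' (edgeSet '' A) := (edgeSet_injective.preimage_image A).symm
    rw [h]
    exact measurable_edgeSet (Set.toFinite _).measurableSet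

/-- The law of the independent edge indicators. -/
noncomputable def edgeLaw (V : Type*) [Fintype V] (p : unitInterval) :
    Measure (Sym2 V → Prop) :=
  Measure.infinitePi fun e : Sym2 V => unitInterval.toNNReal p • Measure.dirac (e ∈ Sym2.diagSetᶜ) +
    unitInterval.toNNReal (unitInterval.symm p) • Measure.dirac False

lemma binomialRandom_apply_eq_edgeLaw (A : Set (SimpleGraph V)) :
    binomialRandom V p A = edgeLaw V p (graphOf ⁻¹' A) := by
  rw [binomialRandom_eq_map, Measure.map_apply measurable_fromEdgeSet (.of_discrete),
    setBernoulli_apply']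
  rfl

/-- The edge indicators are independent coordinates of a product measure, so their restrictions to
disjoint sets of coordinates are independent. This replaces conditioning on the exposed part of the
graph. -/
lemma binomialRandom_inter {F F' : Set (Sym2 V)} {A B : Set (SimpleGraph V)}
    (hA : DeterminedBy F A) (hB : DeterminedBy F' B) (hF : Disjoint F F') :
    (binomialRandom V p).real (A ∩ B) =
      (binomialRandom V p).real A * (binomialRandom V p).real B := by
  classical
  have hind : iIndepFun (fun (e : Sym2 V) (ω : Sym2 V → Prop) => ω e) (edgeLaw V p) :=
    iIndepFun_infinitePi (X := fun _ x => x) (fun _ => measurable_id)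
  have h := hind.indepFun_finset F.toFinite.toFinset F'.toFinite.toFinset (by
    rw [Finset.disjoint_left]
    intro e he he'
    exact Set.disjoint_left.1 hF (by simpa using he) (by simpa using he'))
    (fun e => measurable_pi_apply e)
  have key : ∀ {F : Set (Sym2 V)} {A : Set (SimpleGraph V)}, DeterminedBy F A →
      ∃ A' : Set (F.toFinite.toFinset → Prop), MeasurableSet A' ∧
      graphOf ⁻¹' A = (fun (ω : Sym2 V → Prop) (e : F.toFinite.toFinset) => ω e) ⁻¹' A' := by
    intro F A hA
    -- Pairs outside `F` are declared to be non-edges, which `A` cannot detect.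
    refine ⟨{x | graphOf (fun e => ∃ he : e ∈ F.toFinite.toFinset, x ⟨e, he⟩) ∈ A},
      (Set.toFinite _).measurableSet, ?_⟩
    ext ω
    refine hA _ _ fun e he => ?_
    simp [graphOf, he]
  obtain ⟨A', hmA, hA'⟩ := key hA
  obtain ⟨B', hmB, hB'⟩ := key hB
  simp only [measureReal_def, binomialRandom_apply_eq_edgeLaw, Set.preimage_inter, hA', hB']
  rw [h.measure_inter_preimage_eq_mul _ _ hmA hmB, ENNReal.toReal_mul]

lemma binomialRandom_adj {u v : V} (h : u ≠ v) :
    (binomialRandom V p).real {G | G.Adj u v} = p := by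
  have h1 : graphOf ⁻¹' {G : SimpleGraph V | G.Adj u v} =
      (fun ω : Sym2 V → Prop => ω s(u, v)) ⁻¹' {True} := by
    ext ω; simp [graphOf, h]
  rw [measureReal_def, binomialRandom_apply_eq_edgeLaw, h1,
    ← Measure.map_apply (measurable_pi_apply _) (.of_discrete), edgeLaw, Measure.infinitePi_map_eval]
  simp [h]

lemma binomialRandom_not_adj {u v : V} (h : u ≠ v) :
    (binomialRandom V p).real {G | ¬ G.Adj u v} = 1 - p := by
  rw [← binomialRandom_adj h, ← probReal_compl_eq_one_sub (.of_discrete)]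
  rfl

/-- Averaging a conditional bound over the values of a random variable. -/
lemma measureReal_le_of_fiber {Ω ι : Type*} [MeasurableSpace Ω] [DiscreteMeasurableSpace Ω]
    [Finite ι] (μ : Measure Ω) [IsProbabilityMeasure μ] (f : Ω → ι) (A : Set Ω) {b : ℝ}
    (h : ∀ x, μ.real (f ⁻¹' {x} ∩ A) ≤ μ.real (f ⁻¹' {x}) * b) : μ.real A ≤ b := by
  classical
  cases nonempty_fintype ι
  have hd : Pairwise (Function.onFun Disjoint fun x => f ⁻¹' {x}) := fun x y hxy =>
    Disjoint.preimage f (by simpa using hxy)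
  have h1 : A = ⋃ x ∈ (Finset.univ : Finset ι), f ⁻¹' {x} ∩ A := by ext; simp
  have h2 : ∑ x, μ.real (f ⁻¹' {x}) = 1 := by
    rw [← measureReal_biUnion_finset (fun x _ y _ hxy => hd hxy) (fun _ _ => .of_discrete)]
    have : ⋃ x ∈ (Finset.univ : Finset ι), f ⁻¹' {x} = Set.univ := by ext; simp
    rw [this, probReal_univ]
  calc μ.real A = μ.real (⋃ x ∈ (Finset.univ : Finset ι), f ⁻¹' {x} ∩ A) := by rw [← h1]
    _ ≤ ∑ x, μ.real (f ⁻¹' {x} ∩ A) := measureReal_biUnion_finset_le _ _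
    _ ≤ ∑ x, μ.real (f ⁻¹' {x}) * b := Finset.sum_le_sum fun x _ => h x
    _ = b := by rw [← Finset.sum_mul, h2, one_mul]

end

/-! ### Neighbourhoods, searches, and tail bounds for one layer -/

section

section Pairs

variable {V : Type*}

/-- The pairs with one point in `S` and one point in `U`. -/
def pairsBetween (S U : Finset V) : Set (Sym2 V) := {e | ∃ a ∈ S, ∃ w ∈ U, e = s(a, w)}

lemma pairsBetween_mono {S S' U U' : Finset V} (hS : S ⊆ S') (hU : U ⊆ U') :
    pairsBetween S U ⊆ pairsBetween S' U' := by
  rintro e ⟨a, ha, w, hw, rfl⟩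
  exact ⟨a, hS ha, w, hU hw, rfl⟩

lemma disjoint_pairsBetween {S U W W' : Finset V} (hW : Disjoint S W) (hW' : Disjoint S W') :
    Disjoint (pairsBetween S U) (pairsBetween W W') := by
  rw [Set.disjoint_left]
  rintro e ⟨a, ha, w, hw, rfl⟩ ⟨b, hb, x, hx, h⟩
  rw [Sym2.eq_iff] at h
  rcases h with ⟨rfl, rfl⟩ | ⟨rfl, rfl⟩
  · exact Finset.disjoint_left.1 hW ha hb
  · exact Finset.disjoint_left.1 hW' ha hx

lemma adj_iff_of_agree {F : Set (Sym2 V)} {G G' : SimpleGraph V}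
    (h : ∀ e ∈ F, e ∈ G.edgeSet ↔ e ∈ G'.edgeSet) {a b : V} (hab : s(a, b) ∈ F) :
    G.Adj a b ↔ G'.Adj a b := by
  simpa using h _ hab

open Classical in
/-- The vertices of `U` with a neighbour in `S`. -/
noncomputable def nbrIn (G : SimpleGraph V) (S U : Finset V) : Finset V :=
  U.filter fun w => ∃ a ∈ S, G.Adj a w

lemma mem_nbrIn {G : SimpleGraph V} {S U : Finset V} {w : V} :
    w ∈ nbrIn G S U ↔ w ∈ U ∧ ∃ a ∈ S, G.Adj a w := by
  simp [nbrIn]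

lemma nbrIn_subset (G : SimpleGraph V) (S U : Finset V) : nbrIn G S U ⊆ U :=
  fun _ h => (mem_nbrIn.1 h).1

lemma nbrIn_mono {G : SimpleGraph V} {S S' U U' : Finset V} (hS : S ⊆ S') (hU : U ⊆ U') :
    nbrIn G S U ⊆ nbrIn G S' U' := fun w h => by
  rw [mem_nbrIn] at h ⊢
  obtain ⟨hw, a, ha, haw⟩ := h
  exact ⟨hU hw, a, hS ha, haw⟩

lemma nbrIn_congr {S U : Finset V} {G G' : SimpleGraph V}
    (h : ∀ e ∈ pairsBetween S U, e ∈ G.edgeSet ↔ e ∈ G'.edgeSet) :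
    nbrIn G S U = nbrIn G' S U := by
  ext w
  simp only [mem_nbrIn]
  refine and_congr_right fun hw => exists_congr fun a => and_congr_right fun ha => ?_
  exact adj_iff_of_agree h ⟨a, ha, w, hw, rfl⟩

lemma determinedBy_nbrIn (S U : Finset V) (P : Finset V → Prop) :
    DeterminedBy (pairsBetween S U) {G | P (nbrIn G S U)} := fun G G' h => by
  simp only [Set.mem_ofPred_eq, nbrIn_congr h]

/-- There is a walk from `S` to `T` of length `k + 1` with all inner vertices in `U`. -/
def Joins (G : SimpleGraph V) (U T : Finset V) : ℕ → Finset V → Prop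
  | 0, S => ∃ a ∈ S, ∃ b ∈ T, G.Adj a b
  | k + 1, S => Joins G U T k (nbrIn G S U)

/-- Layers may revisit vertices in `Joins`. Monotonicity lets the analysis trim each layer and
discard explored vertices, which only makes joining harder. -/
lemma Joins.mono {G : SimpleGraph V} {U U' T : Finset V} (hU : U ⊆ U') {k : ℕ}
    {S S' : Finset V} (hS : S ⊆ S') (h : Joins G U T k S) : Joins G U' T k S' := by
  induction k generalizing S S' with
  | zero =>
    obtain ⟨a, ha, b, hb, hab⟩ := h
    exact ⟨a, hS ha, b, hb, hab⟩
  | succ k ih => exact ih (nbrIn_mono hS hU) h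

lemma Joins.exists_walk {G : SimpleGraph V} {U T : Finset V} {k : ℕ} {S : Finset V}
    (h : Joins G U T k S) : ∃ a ∈ S, ∃ b ∈ T, ∃ w : G.Walk a b, w.length = k + 1 := by
  induction k generalizing S with
  | zero =>
    obtain ⟨a, ha, b, hb, hab⟩ := h
    exact ⟨a, ha, b, hb, hab.toWalk, by simp⟩
  | succ k ih =>
    obtain ⟨a, ha, b, hb, w, hw⟩ := ih h
    obtain ⟨-, c, hc, hca⟩ := mem_nbrIn.1 ha
    exact ⟨c, hc, b, hb, .cons hca w, by simp [hw]⟩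

lemma Joins.edist_le {G : SimpleGraph V} {U T : Finset V} {k : ℕ} {S : Finset V}
    (h : Joins G U T k S) {u v : V} (hS : ∀ a ∈ S, G.Adj u a) (hT : ∀ b ∈ T, G.Adj v b) :
    G.edist u v ≤ (k : ℕ∞) + 3 := by
  obtain ⟨a, ha, b, hb, w, hw⟩ := h.exists_walk
  let w' : G.Walk u v := .cons (hS a ha) (w.append (hT b hb).symm.toWalk)
  have h1 : w'.length = k + 3 := by simp [w', hw]
  calc G.edist u v ≤ (w'.length : ℕ∞) := SimpleGraph.edist_le w'
    _ = (k : ℕ∞) + 3 := by rw [h1]; push_cast; rfl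

lemma determinedBy_joins {U T S W : Finset V} (hU : U ⊆ W) (hT : T ⊆ W) (hS : S ⊆ W) (k : ℕ) :
    DeterminedBy (pairsBetween W W) {G | Joins G U T k S} := by
  intro G G' h
  simp only [Set.mem_ofPred_eq]
  induction k generalizing S with
  | zero =>
    refine exists_congr fun a => and_congr_right fun ha => exists_congr fun b =>
      and_congr_right fun hb => adj_iff_of_agree h ⟨a, hS ha, b, hT hb, rfl⟩
  | succ k ih =>
    simp only [Joins]
    rw [nbrIn_congr fun e he => h e (pairsBetween_mono hS hU he)]
    exact ih ((nbrIn_subset _ _ _).trans hU)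

end Pairs

variable {V : Type*} [Fintype V] [DecidableEq V] {p : unitInterval}

lemma binomialRandom_no_edge (F : Finset (Sym2 V)) (hF : ∀ e ∈ F, ¬ e.IsDiag) :
    (binomialRandom V p).real {G | ∀ e ∈ F, e ∉ G.edgeSet} = (1 - p) ^ F.card := by
  induction F using Finset.induction_on with
  | empty => simp
  | insert e F he ih =>
    have h1 : {G : SimpleGraph V | ∀ f ∈ insert e F, f ∉ G.edgeSet} =
        {G | e ∉ G.edgeSet} ∩ {G | ∀ f ∈ F, f ∉ G.edgeSet} := by
      ext G; simp
    have hA : DeterminedBy {e} {G : SimpleGraph V | e ∉ G.edgeSet} :=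
      fun G G' h => not_congr (h e rfl)
    have hB : DeterminedBy (F : Set (Sym2 V)) {G : SimpleGraph V | ∀ f ∈ F, f ∉ G.edgeSet} :=
      fun G G' h => forall₂_congr fun f hf => not_congr (h f hf)
    have h2 : (binomialRandom V p).real {G | e ∉ G.edgeSet} = 1 - p := by
      have := hF e (by simp)
      induction e with
      | h u v => simpa using binomialRandom_not_adj (V := V) (p := p) (by simpa using this)
    rw [h1, binomialRandom_inter hA hB (by simpa using he), h2,
      ih fun f hf => hF f (by simp [hf]), Finset.card_insert_of_notMem he, pow_succ']

lemma binomialRandom_no_edge_between {S T : Finset V} (h : Disjoint S T) :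
    (binomialRandom V p).real {G | ∀ a ∈ S, ∀ b ∈ T, ¬ G.Adj a b} =
      (1 - p) ^ (S.card * T.card) := by
  have hne : ∀ a ∈ S, ∀ b ∈ T, a ≠ b := fun a ha b hb => Finset.disjoint_iff_ne.1 h a ha b hb
  have h1 := binomialRandom_no_edge (p := p) ((S ×ˢ T).image fun x => s(x.1, x.2)) (by
    simp only [Finset.mem_image, Finset.mem_product]
    rintro e ⟨⟨a, b⟩, ⟨ha, hb⟩, rfl⟩
    simpa using hne a ha b hb)
  rw [Finset.card_image_of_injOn, Finset.card_product] at h1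
  · rw [← h1]
    congr 1
    ext G
    simp only [Set.mem_ofPred_eq, Finset.mem_image, Finset.mem_product]
    constructor
    · rintro h e ⟨⟨a, b⟩, ⟨ha, hb⟩, rfl⟩
      simpa using h a ha b hb
    · intro h a ha b hb
      simpa using h s(a, b) ⟨(a, b), ⟨ha, hb⟩, rfl⟩
  · rintro ⟨a, b⟩ hab ⟨a', b'⟩ hab' he
    simp only [Finset.coe_product, Set.mem_prod, Finset.mem_coe] at hab hab'
    simp only [Sym2.eq_iff] at he
    rcases he with ⟨rfl, rfl⟩ | ⟨rfl, rfl⟩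
    · rfl
    · exact absurd rfl (hne a hab.1 a hab'.2)

lemma binomialRandom_not_joins_zero {U S T : Finset V} (h : Disjoint S T) :
    (binomialRandom V p).real {G | ¬ Joins G U T 0 S} ≤ Real.exp (-(p * S.card * T.card)) := by
  have h1 : {G : SimpleGraph V | ¬ Joins G U T 0 S} = {G | ∀ a ∈ S, ∀ b ∈ T, ¬ G.Adj a b} := by
    ext G; simp [Joins]
  rw [h1, binomialRandom_no_edge_between h]
  calc (1 - (p : ℝ)) ^ (S.card * T.card) ≤ Real.exp (-p) ^ (S.card * T.card) :=
        pow_le_pow_left₀ (by linarith [p.2.2]) (by linarith [Real.add_one_le_exp (-(p : ℝ))]) _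
    _ = _ := by rw [← Real.exp_nat_mul]; push_cast; ring_nf

/-- The probability that a vertex has a neighbour in a given set of `s` other vertices. -/
noncomputable def hitProb (p : unitInterval) (s : ℕ) : ℝ := 1 - (1 - p) ^ s

/-- Exponential moment bound for the lower tail of the size of a neighbourhood. -/
lemma binomialRandom_card_nbrIn_lt_le {S U : Finset V} (h : Disjoint S U) {r : ℝ} (hr : 0 ≤ r)
    (y : ℝ) :
    (binomialRandom V p).real {G | ((nbrIn G S U).card : ℝ) < y} ≤
      Real.exp (r * y) * (1 - hitProb p S.card * (1 - Real.exp (-r))) ^ U.card := by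
  have hp0 : 0 ≤ (1 - (p : ℝ)) ^ S.card := pow_nonneg (by linarith [p.2.2]) _
  have hp1 : (1 - (p : ℝ)) ^ S.card ≤ 1 :=
    pow_le_one₀ (by linarith [p.2.2]) (by linarith [p.2.1])
  induction U using Finset.induction_on generalizing y with
  | empty =>
    rcases le_or_gt y 0 with hy | hy
    · have : {G : SimpleGraph V | ((nbrIn G S ∅).card : ℝ) < y} = ∅ := by
        ext G
        simp only [Set.mem_ofPred_eq, Set.mem_empty_iff_false, iff_false, not_lt]
        exact hy.trans (by positivity)
      rw [this]
      simp only [measureReal_empty, Finset.card_empty, pow_zero, mul_one]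
      positivity
    · simp only [Finset.card_empty, pow_zero, mul_one]
      exact measureReal_le_one.trans (Real.one_le_exp (by positivity))
  | insert w U hw ih =>
    rw [Finset.disjoint_insert_right] at h
    have hdet := determinedBy_nbrIn (V := V) S {w} fun X => w ∈ X
    have hdisj : Disjoint (pairsBetween S {w}) (pairsBetween S U) := by
      rw [Set.disjoint_left]
      rintro e ⟨a, ha, x, hx, rfl⟩ ⟨b, hb, x', hx', he⟩
      rw [Finset.mem_singleton] at hx
      subst hx
      rw [Sym2.eq_iff] at he
      rcases he with ⟨rfl, rfl⟩ | ⟨rfl, rfl⟩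
      · exact hw hx'
      · exact h.1 hb
    have hmiss : (binomialRandom V p).real {G | w ∈ nbrIn G S {w}}ᶜ = 1 - hitProb p S.card := by
      have := binomialRandom_no_edge_between (p := p) (S := S) (T := {w}) (by simpa using h.1)
      simp only [Finset.card_singleton, mul_one] at this
      rw [hitProb, sub_sub_cancel, ← this]
      congr 1
      ext G
      simp [mem_nbrIn]
    have hhit : (binomialRandom V p).real {G | w ∈ nbrIn G S {w}} = hitProb p S.card := by
      rw [probReal_compl_eq_one_sub (.of_discrete)] at hmiss
      linarith
    -- Expose the pairs between `S` and `w` first: a hit lowers the threshold for the rest to `y -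
    -- 1`, a miss leaves it at `y`. This is why the induction is over all `y`.
    have hsub : {G : SimpleGraph V | ((nbrIn G S (insert w U)).card : ℝ) < y} ⊆
        ({G | w ∈ nbrIn G S {w}} ∩ {G | ((nbrIn G S U).card : ℝ) < y - 1}) ∪
        ({G | w ∈ nbrIn G S {w}}ᶜ ∩ {G | ((nbrIn G S U).card : ℝ) < y}) := by
      intro G hG
      simp only [Set.mem_ofPred_eq] at hG
      by_cases hwG : w ∈ nbrIn G S {w}
      · left
        refine ⟨hwG, ?_⟩
        have h2 : nbrIn G S (insert w U) = insert w (nbrIn G S U) := by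
          ext x
          simp only [mem_nbrIn, Finset.mem_insert, Finset.mem_singleton, true_and] at hwG ⊢
          constructor
          · rintro ⟨rfl | hx, ha⟩
            · exact .inl rfl
            · exact .inr ⟨hx, ha⟩
          · rintro (rfl | ⟨hx, ha⟩)
            · exact ⟨.inl rfl, hwG⟩
            · exact ⟨.inr hx, ha⟩
        rw [h2, Finset.card_insert_of_notMem fun hx => hw (nbrIn_subset _ _ _ hx)] at hG
        push_cast at hG
        simp only [Set.mem_ofPred_eq]
        linarith
      · right
        refine ⟨hwG, ?_⟩
        have h2 := Finset.card_le_card (nbrIn_mono (G := G) (Finset.Subset.refl S)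
          (Finset.subset_insert w U))
        simp only [Set.mem_ofPred_eq]
        exact lt_of_le_of_lt (by exact_mod_cast h2) hG
    have hd1 := determinedBy_nbrIn (V := V) S U fun X => (X.card : ℝ) < y - 1
    have hd2 := determinedBy_nbrIn (V := V) S U fun X => (X.card : ℝ) < y
    have hq0 : 0 ≤ hitProb p S.card := by rw [hitProb]; linarith
    have hq1 : 0 ≤ 1 - hitProb p S.card := by rw [hitProb]; linarith
    calc _ ≤ _ := measureReal_mono hsub
      _ ≤ _ := measureReal_union_le _ _
      _ ≤ hitProb p S.card * (Real.exp (r * (y - 1)) *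
            (1 - hitProb p S.card * (1 - Real.exp (-r))) ^ U.card) +
          (1 - hitProb p S.card) * (Real.exp (r * y) *
            (1 - hitProb p S.card * (1 - Real.exp (-r))) ^ U.card) := by
        rw [binomialRandom_inter hdet hd1 hdisj, binomialRandom_inter hdet.compl hd2 hdisj,
          hmiss, hhit]
        exact add_le_add (mul_le_mul_of_nonneg_left (ih h.2 _) hq0)
          (mul_le_mul_of_nonneg_left (ih h.2 _) hq1)
      _ = _ := by
        rw [Finset.card_insert_of_notMem hw, pow_succ, show r * (y - 1) = r * y + -r by ring,
          Real.exp_add]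
        ring

lemma binomialRandom_card_nbrIn_lt_le_exp {S U : Finset V} (h : Disjoint S U) {r : ℝ} (hr : 0 ≤ r)
    (y : ℝ) :
    (binomialRandom V p).real {G | ((nbrIn G S U).card : ℝ) < y} ≤
      Real.exp (r * y - U.card * hitProb p S.card * (1 - Real.exp (-r))) := by
  refine (binomialRandom_card_nbrIn_lt_le h hr y).trans ?_
  rw [sub_eq_add_neg (r * y), Real.exp_add]
  refine mul_le_mul_of_nonneg_left ?_ (Real.exp_pos _).le
  have hp0 : 0 ≤ (1 - (p : ℝ)) ^ S.card := pow_nonneg (by linarith [p.2.2]) _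
  have h3 : Real.exp (-r) ≤ 1 := Real.exp_le_one_iff.2 (by linarith)
  have h1 : 0 ≤ 1 - hitProb p S.card * (1 - Real.exp (-r)) := by
    rw [hitProb]; nlinarith [Real.exp_pos (-r)]
  calc _ ≤ Real.exp (-(hitProb p S.card * (1 - Real.exp (-r)))) ^ U.card :=
        pow_le_pow_left₀ h1
          (by linarith [Real.add_one_le_exp (-(hitProb p S.card * (1 - Real.exp (-r))))]) _
    _ = _ := by rw [← Real.exp_nat_mul]; ring_nf

end

/-! ### Layer-by-layer exposure, pairs of vertices, and path counting -/

section

lemma exp_neg_le_quadratic {x : ℝ} (hx : 0 ≤ x) : Real.exp (-x) ≤ 1 - x + x ^ 2 / 2 := by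
  have h := Real.quadratic_le_exp_of_nonneg hx
  have h1 : 0 < Real.exp (-x) := Real.exp_pos _
  have h2 : Real.exp (-x) * Real.exp x = 1 := by rw [← Real.exp_add]; simp
  have h3 : Real.exp (-x) * (1 + x + x ^ 2 / 2) ≤ 1 := by nlinarith
  have h4 : (0 : ℝ) < 1 + x + x ^ 2 / 2 := by positivity
  have h5 : 1 ≤ (1 - x + x ^ 2 / 2) * (1 + x + x ^ 2 / 2) := by nlinarith [sq_nonneg (x ^ 2)]
  exact le_of_mul_le_mul_right (h3.trans h5) h4

/-- From `(1 - p) ^ s ≤ exp (-p y)` and the quadratic bound. Allowing any `y ≤ s` means that only a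
lower bound on a layer is ever needed. -/
lemma le_hitProb (p : unitInterval) {s : ℕ} {y : ℝ} (hy : 0 ≤ y) (hys : y ≤ s) :
    p * y * (1 - p * y / 2) ≤ hitProb p s := by
  have h0 : (0 : ℝ) ≤ p := p.2.1
  have h1 : (1 - (p : ℝ)) ^ s ≤ Real.exp (-(p * y)) := by
    calc (1 - (p : ℝ)) ^ s ≤ Real.exp (-p) ^ s :=
          pow_le_pow_left₀ (by linarith [p.2.2]) (by linarith [Real.add_one_le_exp (-(p : ℝ))]) _
      _ = Real.exp (-(p * s)) := by rw [← Real.exp_nat_mul]; ring_nf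
      _ ≤ _ := Real.exp_le_exp.2 (neg_le_neg (mul_le_mul_of_nonneg_left hys h0))
  have h2 := exp_neg_le_quadratic (mul_nonneg h0 hy)
  rw [hitProb]
  nlinarith

lemma exists_subset_card_eq_ceil {V : Type*} {X : Finset V} {y : ℝ} (h : y ≤ X.card) :
    ∃ S ⊆ X, S.card = ⌈y⌉₊ :=
  Finset.exists_subset_card_eq (Nat.ceil_le.2 h)

section Paths

variable {V : Type*} [DecidableEq V]

/-- There is a path of length `i + 1` from `u` to `v` with inner vertices in `W`. -/
def ReachIn (G : SimpleGraph V) (v : V) : ℕ → Finset V → V → Prop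
  | 0, _, u => G.Adj u v
  | i + 1, W, u => ∃ w ∈ W, G.Adj u w ∧ ReachIn G v i (W.erase w) w

lemma determinedBy_reachIn {v : V} (i : ℕ) {W X : Finset V} {u : V} (hv : v ∈ X) (hu : u ∈ X)
    (hW : W ⊆ X) : DeterminedBy (pairsBetween X X) {G | ReachIn G v i W u} := by
  intro G G' h
  simp only [Set.mem_ofPred_eq]
  induction i generalizing W u with
  | zero => exact adj_iff_of_agree h ⟨u, hu, v, hv, rfl⟩
  | succ i ih =>
    refine exists_congr fun w => and_congr_right fun hw => and_congr ?_ ?_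
    · exact adj_iff_of_agree h ⟨u, hu, w, hW hw, rfl⟩
    · exact ih (hW hw) ((Finset.erase_subset _ _).trans hW)

lemma reachIn_of_isPath {G : SimpleGraph V} {u v : V} (q : G.Walk u v) (hq : q.IsPath)
    (huv : u ≠ v) {W : Finset V} (hW : ∀ x ∈ q.support, x ≠ u → x ≠ v → x ∈ W) :
    ReachIn G v (q.length - 1) W u := by
  induction q generalizing W with
  | nil => exact absurd rfl huv
  | @cons u w v h q ih =>
    rw [Walk.cons_isPath_iff] at hq
    by_cases hwv : w = v
    · subst hwv
      have h0 := Walk.length_eq_zero_iff.2 (Walk.isPath_iff_nil.1 hq.1)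
      rw [Walk.length_cons, Nat.add_sub_cancel, h0]
      exact h
    · obtain ⟨j, hj⟩ : ∃ j, q.length = j + 1 :=
        Nat.exists_eq_succ_of_ne_zero fun h0 => hwv (Walk.eq_of_length_eq_zero h0)
      have h1 := ih hq.1 hwv (W := W.erase w) fun x hx hxw hxv => Finset.mem_erase.2 ⟨hxw,
        hW x (by simp [hx]) (by rintro rfl; exact hq.2 hx) hxv⟩
      rw [hj, Nat.add_sub_cancel] at h1
      rw [Walk.length_cons, Nat.add_sub_cancel, hj]
      exact ⟨w, hW w (by simp) h.ne' hwv, h, h1⟩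

end Paths

variable {V : Type*} [Fintype V] [DecidableEq V] {p : unitInterval}

/-- Lower tail Chernoff bound for the size of a neighbourhood. -/
lemma binomialRandom_card_nbrIn_lt_le_chernoff {S U : Finset V} (h : Disjoint S U) {η m y : ℝ}
    (hη : 0 ≤ η) (hη1 : η ≤ 1) (hm : m ≤ U.card * hitProb p S.card) (hy : y ≤ (1 - η) * m) :
    (binomialRandom V p).real {G | ((nbrIn G S U).card : ℝ) < y} ≤
      Real.exp (-(η ^ 2 * m / 2)) := by
  refine (binomialRandom_card_nbrIn_lt_le_exp h hη y).trans (Real.exp_le_exp.2 ?_)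
  have h1 := exp_neg_le_quadratic hη
  have h2 : 0 ≤ U.card * hitProb p S.card := by
    have : (1 - (p : ℝ)) ^ S.card ≤ 1 :=
      pow_le_one₀ (by linarith [p.2.2]) (by linarith [p.2.1])
    rw [hitProb]
    exact mul_nonneg (by positivity) (by linarith)
  have h3 : 0 ≤ η - η ^ 2 / 2 := by nlinarith
  have h4 : m * (η - η ^ 2 / 2) ≤ U.card * hitProb p S.card * (1 - Real.exp (-η)) :=
    mul_le_mul hm (by linarith) h3 h2
  nlinarith [mul_le_mul_of_nonneg_left hy hη]

/-- Exposing one more layer of a search. -/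
lemma binomialRandom_not_joins_succ {U S T : Finset V} (hSU : Disjoint S U) (hST : Disjoint S T)
    {k : ℕ} {y β B : ℝ} (hB : 0 ≤ B)
    (hβ : (binomialRandom V p).real {G | ((nbrIn G S U).card : ℝ) < y} ≤ β)
    (h : ∀ S' ⊆ U, S'.card = ⌈y⌉₊ →
      (binomialRandom V p).real {G | ¬ Joins G (U \ S') T k S'} ≤ B) :
    (binomialRandom V p).real {G | ¬ Joins G U T (k + 1) S} ≤ β + B := by
  have hsub : {G : SimpleGraph V | ¬ Joins G U T (k + 1) S} ⊆
      {G | ((nbrIn G S U).card : ℝ) < y} ∪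
      {G | y ≤ (nbrIn G S U).card ∧ ¬ Joins G U T (k + 1) S} := fun G hG => by
    rcases lt_or_ge ((nbrIn G S U).card : ℝ) y with h1 | h1
    · exact .inl h1
    · exact .inr ⟨h1, hG⟩
  refine (measureReal_mono hsub).trans ((measureReal_union_le _ _).trans (add_le_add hβ ?_))
  -- Condition on the next layer. Its value depends on the pairs between `S` and `U`, while the rest
  -- of the search uses pairs inside `U ∪ T`, which avoids `S`.
  refine measureReal_le_of_fiber _ (fun G => nbrIn G S U) _ fun X => ?_
  by_cases hX : y ≤ X.card ∧ X ⊆ U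
  · obtain ⟨S', hS'X, hS'⟩ := exists_subset_card_eq_ceil hX.1
    have hS'U := hS'X.trans hX.2
    have hsub' : (fun G => nbrIn G S U) ⁻¹' {X} ∩
        {G | y ≤ (nbrIn G S U).card ∧ ¬ Joins G U T (k + 1) S} ⊆
        {G | nbrIn G S U = X} ∩ {G | ¬ Joins G (U \ S') T k S'} := by
      rintro G ⟨rfl, -, hG⟩
      exact ⟨rfl, fun hJ => hG (show Joins G U T k (nbrIn G S U) from
        hJ.mono Finset.sdiff_subset hS'X)⟩
    have hdis := disjoint_pairsBetween (S := S) (U := U) (W := U ∪ T) (W' := U ∪ T)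
      (Finset.disjoint_union_right.2 ⟨hSU, hST⟩) (Finset.disjoint_union_right.2 ⟨hSU, hST⟩)
    have hdet := determinedBy_joins (U := U \ S') (T := T) (S := S') (W := U ∪ T)
      (Finset.sdiff_subset.trans Finset.subset_union_left) Finset.subset_union_right
      (hS'U.trans Finset.subset_union_left) k
    have hdet' : DeterminedBy _ {G | ¬ Joins G (U \ S') T k S'} := hdet.compl
    refine (measureReal_mono hsub').trans ?_
    rw [binomialRandom_inter (determinedBy_nbrIn S U fun Y => Y = X) hdet' hdis]
    exact mul_le_mul_of_nonneg_left (h S' hS'U hS') measureReal_nonneg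
  · have : (fun G => nbrIn G S U) ⁻¹' {X} ∩
        {G | y ≤ (nbrIn G S U).card ∧ ¬ Joins G U T (k + 1) S} = ∅ := by
      ext G
      simp only [Set.mem_inter_iff, Set.mem_preimage, Set.mem_singleton_iff, Set.mem_ofPred_eq,
        Set.mem_empty_iff_false, iff_false]
      rintro ⟨rfl, hy, -⟩
      exact hX ⟨hy, nbrIn_subset _ _ _⟩
    rw [this, measureReal_empty]
    exact mul_nonneg measureReal_nonneg hB

/-- Exposing `k` layers of a search, the `i`-th of size about `y i` within at least `m i`
unexplored vertices. -/
lemma binomialRandom_not_joins_add {T : Finset V} {y m : ℕ → ℝ} {β B : ℝ} (hβ : 0 ≤ β)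
    (hB : 0 ≤ B) (j k i : ℕ) (hy : ∀ l, i ≤ l → l < i + k → 0 ≤ y (l + 1))
    (hm : ∀ l, i ≤ l → l < i + k → m (l + 1) + y (l + 1) + 1 ≤ m l)
    (hstep : ∀ l, i ≤ l → l < i + k → ∀ S U : Finset V, Disjoint S U → y l ≤ S.card →
      m l ≤ U.card → (binomialRandom V p).real {G | ((nbrIn G S U).card : ℝ) < y (l + 1)} ≤ β)
    (hend : ∀ S U : Finset V, Disjoint S U → Disjoint S T → Disjoint U T → y (i + k) ≤ S.card →
      m (i + k) ≤ U.card → (binomialRandom V p).real {G | ¬ Joins G U T j S} ≤ B)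
    {S U : Finset V} (hSU : Disjoint S U) (hST : Disjoint S T) (hUT : Disjoint U T)
    (hS : y i ≤ S.card) (hU : m i ≤ U.card) :
    (binomialRandom V p).real {G | ¬ Joins G U T (j + k) S} ≤ k * β + B := by
  induction k generalizing i S U with
  | zero => simpa using hend S U hSU hST hUT hS hU
  | succ k ih =>
    have h := binomialRandom_not_joins_succ (k := j + k) hSU hST (B := k * β + B) (by positivity)
      (hstep i le_rfl (by omega) S U hSU hS hU) ?_
    · refine h.trans (le_of_eq ?_)
      push_cast
      ring
    · intro S' hS'U hS'
      refine ih (i + 1) (fun l h1 h2 => hy l (by omega) (by omega))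
        (fun l h1 h2 => hm l (by omega) (by omega)) (fun l h1 h2 => hstep l (by omega) (by omega))
        (by rw [show i + 1 + k = i + (k + 1) by ring]; exact hend)
        Finset.disjoint_sdiff (hUT.mono_left hS'U) (hUT.mono_left Finset.sdiff_subset) ?_ ?_
      · rw [hS']; exact Nat.le_ceil _
      · have h1 := Finset.card_sdiff_add_card_eq_card hS'U
        have h2 : ((U \ S').card : ℝ) + S'.card = U.card := by exact_mod_cast h1
        have h3 := hm i le_rfl (by omega)
        have h4 := Nat.ceil_lt_add_one (hy i le_rfl (by omega))
        rw [← hS'] at h4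
        linarith

/-- Joining the neighbourhoods of two vertices. -/
lemma binomialRandom_pair {u v : V} {y B : ℝ} {k : ℕ} (hB : 0 ≤ B)
    (h : ∀ S ⊆ ({u, v} : Finset V)ᶜ, ∀ T ⊆ ({u, v} : Finset V)ᶜ, Disjoint S T →
      S.card = ⌈y⌉₊ → T.card = ⌈y⌉₊ →
      (binomialRandom V p).real {G | ¬ Joins G ((({u, v} : Finset V)ᶜ \ S) \ T) T k S} ≤ B) :
    (binomialRandom V p).real {G | y ≤ (nbrIn G {u} ({u, v} : Finset V)ᶜ).card ∧
      y ≤ (nbrIn G {v} ({u, v} : Finset V)ᶜ).card ∧ ¬ G.edist u v ≤ (k : ℕ∞) + 3} ≤ B := by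
  set W := ({u, v} : Finset V)ᶜ with hW
  refine measureReal_le_of_fiber _ (fun G => (nbrIn G {u} W, nbrIn G {v} W)) _ fun ⟨X, Y⟩ => ?_
  -- Other values `X`, `Y` contribute nothing: a common neighbour puts `u` and `v` at distance at
  -- most 2.
  by_cases hXY : y ≤ X.card ∧ y ≤ Y.card ∧ X ⊆ W ∧ Y ⊆ W ∧ Disjoint X Y
  · obtain ⟨hX, hY, hXW, hYW, hdXY⟩ := hXY
    obtain ⟨S, hSX, hS⟩ := exists_subset_card_eq_ceil hX
    obtain ⟨T, hTY, hT⟩ := exists_subset_card_eq_ceil hY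
    have hsub : (fun G => (nbrIn G {u} W, nbrIn G {v} W)) ⁻¹' {(X, Y)} ∩
        {G | y ≤ (nbrIn G {u} W).card ∧ y ≤ (nbrIn G {v} W).card ∧
          ¬ G.edist u v ≤ (k : ℕ∞) + 3} ⊆
        ({G | nbrIn G {u} W = X} ∩ {G | nbrIn G {v} W = Y}) ∩
          {G | ¬ Joins G ((W \ S) \ T) T k S} := by
      rintro G ⟨hG, -, -, hd⟩
      simp only [Set.mem_preimage, Set.mem_singleton_iff, Prod.mk.injEq] at hG
      refine ⟨hG, fun hJ => hd (hJ.edist_le ?_ ?_)⟩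
      · intro a ha
        have := hSX ha
        rw [← hG.1, mem_nbrIn] at this
        simpa using this.2
      · intro b hb
        have := hTY hb
        rw [← hG.2, mem_nbrIn] at this
        simpa using this.2
    have hdis := disjoint_pairsBetween (S := {u, v}) (U := W) (W := W) (W' := W)
      disjoint_compl_right disjoint_compl_right
    have hdet := determinedBy_joins (U := (W \ S) \ T) (T := T) (S := S) (W := W)
      (Finset.sdiff_subset.trans Finset.sdiff_subset) (hTY.trans hYW) (hSX.trans hXW) k
    have hdet' : DeterminedBy _ {G | ¬ Joins G ((W \ S) \ T) T k S} := hdet.compl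
    have h1 := (determinedBy_nbrIn {u} W fun Z => Z = X).mono
      (pairsBetween_mono (S' := {u, v}) (by simp) (Finset.Subset.refl W))
    have h2 := (determinedBy_nbrIn {v} W fun Z => Z = Y).mono
      (pairsBetween_mono (S' := {u, v}) (by simp) (Finset.Subset.refl W))
    refine (measureReal_mono hsub).trans ?_
    rw [binomialRandom_inter (h1.inter h2) hdet' hdis]
    have h3 : (fun G => (nbrIn G {u} W, nbrIn G {v} W)) ⁻¹' {(X, Y)} =
        {G | nbrIn G {u} W = X} ∩ {G | nbrIn G {v} W = Y} := by
      ext G; simp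
    rw [h3]
    exact mul_le_mul_of_nonneg_left (h S (hSX.trans hXW) T (hTY.trans hYW)
      (hdXY.mono hSX hTY) hS hT) measureReal_nonneg
  · have : (fun G => (nbrIn G {u} W, nbrIn G {v} W)) ⁻¹' {(X, Y)} ∩
        {G | y ≤ (nbrIn G {u} W).card ∧ y ≤ (nbrIn G {v} W).card ∧
          ¬ G.edist u v ≤ (k : ℕ∞) + 3} = ∅ := by
      ext G
      simp only [Set.mem_inter_iff, Set.mem_preimage, Set.mem_singleton_iff, Set.mem_ofPred_eq,
        Set.mem_empty_iff_false, iff_false, Prod.mk.injEq]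
      rintro ⟨⟨rfl, rfl⟩, hX, hY, hd⟩
      refine hXY ⟨hX, hY, nbrIn_subset _ _ _, nbrIn_subset _ _ _, ?_⟩
      rw [Finset.disjoint_left]
      intro w hw hw'
      simp only [mem_nbrIn, Finset.mem_singleton, exists_eq_left] at hw hw'
      refine hd ?_
      calc G.edist u v ≤ ((Walk.cons hw.2 hw'.2.symm.toWalk).length : ℕ∞) := SimpleGraph.edist_le _
        _ = 2 := by simp
        _ ≤ 3 := by norm_num
        _ ≤ (k : ℕ∞) + 3 := le_add_self
    rw [this, measureReal_empty]
    exact mul_nonneg measureReal_nonneg hB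

/-- Large degrees and joined pairs give a small diameter. -/
lemma binomialRandom_not_ediam_le {y D B : ℝ} {k : ℕ} (hB : 0 ≤ B)
    (hD : ∀ u : V, (binomialRandom V p).real
      {G | ((nbrIn G {u} ({u} : Finset V)ᶜ).card : ℝ) < y + 1} ≤ D)
    (h : ∀ u v : V, u ≠ v → ∀ S ⊆ ({u, v} : Finset V)ᶜ, ∀ T ⊆ ({u, v} : Finset V)ᶜ,
      Disjoint S T → S.card = ⌈y⌉₊ → T.card = ⌈y⌉₊ →
      (binomialRandom V p).real {G | ¬ Joins G ((({u, v} : Finset V)ᶜ \ S) \ T) T k S} ≤ B) :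
    (binomialRandom V p).real {G | ¬ G.ediam ≤ (k : ℕ∞) + 3} ≤
      Fintype.card V * D + (Fintype.card V : ℝ) ^ 2 * B := by
  have hsub : {G : SimpleGraph V | ¬ G.ediam ≤ (k : ℕ∞) + 3} ⊆
      (⋃ u ∈ (Finset.univ : Finset V),
        {G | ((nbrIn G {u} ({u} : Finset V)ᶜ).card : ℝ) < y + 1}) ∪
      (⋃ x ∈ (Finset.univ : Finset (V × V)), {G | x.1 ≠ x.2 ∧
        (y ≤ (nbrIn G {x.1} ({x.1, x.2} : Finset V)ᶜ).card ∧
        y ≤ (nbrIn G {x.2} ({x.1, x.2} : Finset V)ᶜ).card ∧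
          ¬ G.edist x.1 x.2 ≤ (k : ℕ∞) + 3)}) := by
    intro G hG
    by_cases hdeg : ∃ u, ((nbrIn G {u} ({u} : Finset V)ᶜ).card : ℝ) < y + 1
    · obtain ⟨u, hu⟩ := hdeg
      left
      simp only [Set.mem_iUnion]
      exact ⟨u, Finset.mem_univ _, hu⟩
    · right
      push Not at hdeg
      simp only [Set.mem_ofPred_eq, ediam_le_iff, not_forall] at hG
      obtain ⟨u, v, huv⟩ := hG
      have hne : u ≠ v := by
        rintro rfl
        simp at huv
      -- Removing the other vertex of the pair costs at most one neighbour, hence the `y + 1` in the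
      -- degree hypothesis.
      have hle : ∀ a b c : V, (c = a ∨ c = b) → y ≤ (nbrIn G {c} ({a, b} : Finset V)ᶜ).card := by
        intro a b c hc
        have h1 : nbrIn G {c} ({c} : Finset V)ᶜ ⊆
            insert (if c = a then b else a) (nbrIn G {c} ({a, b} : Finset V)ᶜ) := by
          intro w
          simp only [mem_nbrIn, Finset.mem_insert, Finset.mem_compl, Finset.mem_singleton]
          rintro ⟨h1, h2⟩
          by_cases h3 : w = if c = a then b else a
          · exact .inl h3
          · refine .inr ⟨?_, h2⟩
            grind
        have h2 := (Finset.card_le_card h1).trans (Finset.card_insert_le _ _)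
        have h3 : ((nbrIn G {c} ({c} : Finset V)ᶜ).card : ℝ) ≤
          (nbrIn G {c} ({a, b} : Finset V)ᶜ).card + 1 := by exact_mod_cast h2
        linarith [hdeg c]
      simp only [Set.mem_iUnion]
      exact ⟨(u, v), Finset.mem_univ _, hne, hle u v u (.inl rfl), hle u v v (.inr rfl), huv⟩
  refine (measureReal_mono hsub).trans ((measureReal_union_le _ _).trans (add_le_add ?_ ?_))
  · refine (measureReal_biUnion_finset_le _ _).trans ((Finset.sum_le_sum fun u _ => hD u).trans ?_)
    simp
  · refine (measureReal_biUnion_finset_le _ _).trans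
      ((Finset.sum_le_sum (g := fun _ => B) fun x _ => ?_).trans ?_)
    · by_cases hx : x.1 = x.2
      · simpa [hx] using hB
      · simpa [hx] using binomialRandom_pair hB (h x.1 x.2 hx)
    · simp [sq]

/-- Each inner vertex has at most `Fintype.card V` choices and each edge costs a factor `p`. The
rest of the path lives in `insert v W`, which omits `u`, so the first edge is independent of it;
erasing `w` preserves this condition in the recursion. -/
lemma binomialRandom_reachIn {v : V} (i : ℕ) {W : Finset V} {u : V} (huv : u ≠ v) (hu : u ∉ W)
    (hv : v ∉ W) :
    (binomialRandom V p).real {G | ReachIn G v i W u} ≤ p * (Fintype.card V * p : ℝ) ^ i := by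
  have hp : (0 : ℝ) ≤ p := p.2.1
  induction i generalizing W u with
  | zero => simpa [ReachIn] using (binomialRandom_adj huv).le
  | succ i ih =>
    have hsub : {G : SimpleGraph V | ReachIn G v (i + 1) W u} ⊆
        ⋃ w ∈ W, {G | G.Adj u w} ∩ {G | ReachIn G v i (W.erase w) w} := by
      rintro G ⟨w, hw, h⟩
      simp only [Set.mem_iUnion]
      exact ⟨w, hw, h⟩
    have hle : ∀ w ∈ W, (binomialRandom V p).real
        ({G | G.Adj u w} ∩ {G | ReachIn G v i (W.erase w) w}) ≤
        p * (p * (Fintype.card V * p : ℝ) ^ i) := by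
      intro w hw
      have huw : u ≠ w := by rintro rfl; exact hu hw
      rw [binomialRandom_inter (determinedBy_adj u w)
        (determinedBy_reachIn i (X := insert v W) (by simp) (by simp [hw])
          ((Finset.erase_subset _ _).trans (Finset.subset_insert _ _))), binomialRandom_adj huw]
      · exact mul_le_mul_of_nonneg_left (ih (by rintro rfl; exact hv hw) (by simp)
          fun h => hv (Finset.mem_of_mem_erase h)) hp
      · rw [Set.disjoint_singleton_left]
        rintro ⟨a, ha, b, hb, h⟩
        have : u ∈ insert v W := by
          rw [Sym2.eq_iff] at h
          rcases h with ⟨rfl, rfl⟩ | ⟨rfl, rfl⟩ <;> assumption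
        simp [huv, hu] at this
    calc _ ≤ _ := measureReal_mono hsub (measure_ne_top _ _)
      _ ≤ _ := measureReal_biUnion_finset_le _ _
      _ ≤ _ := Finset.sum_le_sum hle
      _ = W.card * (p * (p * (Fintype.card V * p : ℝ) ^ i)) := by simp
      _ ≤ Fintype.card V * (p * (p * (Fintype.card V * p : ℝ) ^ i)) :=
        mul_le_mul_of_nonneg_right (by exact_mod_cast Finset.card_le_univ W) (by positivity)
      _ = _ := by ring

/-- The expected number of short paths bounds the probability of a small distance. -/
lemma binomialRandom_edist_le {u v : V} (huv : u ≠ v) (k : ℕ) :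
    (binomialRandom V p).real {G | G.edist u v ≤ (k : ℕ∞)} ≤
      ∑ i ∈ Finset.range k, p * (Fintype.card V * p : ℝ) ^ i := by
  have hsub : {G : SimpleGraph V | G.edist u v ≤ (k : ℕ∞)} ⊆
      ⋃ i ∈ Finset.range k, {G | ReachIn G v i ({u, v} : Finset V)ᶜ u} := by
    intro G hG
    simp only [Set.mem_ofPred_eq] at hG
    have hr : G.Reachable u v := by
      rw [← edist_ne_top_iff_reachable]
      exact (hG.trans_lt (ENat.natCast_lt_top k)).ne
    obtain ⟨q, hq, hl⟩ := hr.exists_path_of_dist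
    have h1 : (q.length : ℕ∞) ≤ k := by rwa [hl, hr.coe_dist_eq_edist]
    have h2 : q.length ≤ k := by exact_mod_cast h1
    have h3 : q.length ≠ 0 := fun h0 => huv (Walk.eq_of_length_eq_zero h0)
    simp only [Set.mem_iUnion]
    exact ⟨q.length - 1, Finset.mem_range.2 (by omega), reachIn_of_isPath q hq huv
      fun x _ hxu hxv => by simp [hxu, hxv]⟩
  refine (measureReal_mono hsub (measure_ne_top _ _)).trans ((measureReal_biUnion_finset_le _ _).trans
    (Finset.sum_le_sum fun i _ => binomialRandom_reachIn i huv (by simp) (by simp)))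

end

/-! ### Explicit constants, layer sizes, and failure bounds at fixed `n` -/

section

/-- The left side is the coefficient of `d` in the exponent of the small-degree bound; it tends to
`-1` as `r → ∞` and `r δ → 0`. With `d ≥ c log n` the value on the right gives `n ^ (-(c + 1) / 2)`,
which is `o(1 / n)` because `c > 1`. -/
lemma exists_degree_constants {c : ℝ} (hc : 1 < c) : ∃ r δ : ℝ, 0 < r ∧ 0 < δ ∧ δ ≤ 1 / 4 ∧
    r * δ - (1 - Real.exp (-r)) ≤ -((c + 1) / (2 * c)) := by
  have h1 : 0 < (c - 1) / (4 * c) := div_pos (by linarith) (by linarith)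
  have h2 : (c - 1) / (4 * c) < 1 := by rw [div_lt_one (by linarith)]; linarith
  set r := -Real.log ((c - 1) / (4 * c)) with hr
  have hr0 : 0 < r := by rw [hr]; linarith [Real.log_neg h1 h2]
  refine ⟨r, min (1 / 4) ((c - 1) / (4 * c) / r), hr0, by positivity, min_le_left _ _, ?_⟩
  have h3 : Real.exp (-r) = (c - 1) / (4 * c) := by rw [hr, neg_neg, Real.exp_log h1]
  have h4 : r * min (1 / 4) ((c - 1) / (4 * c) / r) ≤ (c - 1) / (4 * c) :=
    (mul_le_mul_of_nonneg_left (min_le_right _ _) hr0.le).trans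
      (by rw [mul_div_cancel₀ _ hr0.ne'])
  rw [h3]
  have h5 : -((c + 1) / (2 * c)) = 2 * ((c - 1) / (4 * c)) - 1 := by
    have : c ≠ 0 := by linarith
    field_simp
    ring
  linarith

/-- The sizes of the successive layers of a search in a random graph on `N` vertices of average
degree `d`, starting from a layer of size `δ * d`. -/
noncomputable def layerSize (δ d N : ℝ) (i : ℕ) : ℝ :=
  δ * (1 / 2 + (1 / 2) ^ i / 2 - 10 * (d ^ i / N)) * d ^ i

section layerSize

variable {δ d N : ℝ} {t : ℕ}

lemma pow_div_le_of_le (hd : 4 ≤ d) (hN : 0 < N) (hdt : 40 * d ^ t ≤ N) {i : ℕ} (hi : i ≤ t) :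
    d ^ i / N ≤ 1 / 40 := by
  have : d ^ i ≤ d ^ t := pow_le_pow_right₀ (by linarith) hi
  rw [div_le_iff₀ hN]
  linarith

lemma layerSize_le (hδ : 0 < δ) (hd : 4 ≤ d) (hN : 0 < N) (i : ℕ) :
    layerSize δ d N i ≤ δ * d ^ i := by
  have h1 : (1 / 2 : ℝ) ^ i ≤ 1 := pow_le_one₀ (by norm_num) (by norm_num)
  have h2 : 0 ≤ d ^ i / N := by positivity
  rw [layerSize]
  refine mul_le_mul_of_nonneg_right ?_ (by positivity)
  nlinarith

lemma le_layerSize (hδ : 0 < δ) (hd : 4 ≤ d) (hN : 0 < N) (hdt : 40 * d ^ t ≤ N) {i : ℕ}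
    (hi : i ≤ t) : δ / 4 * d ^ i ≤ layerSize δ d N i := by
  have h1 : 0 ≤ (1 / 2 : ℝ) ^ i := by positivity
  have h2 := pow_div_le_of_le hd hN hdt hi
  rw [layerSize]
  refine mul_le_mul_of_nonneg_right ?_ (by positivity)
  nlinarith

/-- This explains the shape of `layerSize`. Halving the term `(1 / 2) ^ i / 2` pays for a Chernoff
deviation by the fraction `(1 / 2) ^ i / 4`; these fractions are summable, so the total loss is
bounded whatever `t` is. The term `10 * (d ^ i / N)` pays for used-up vertices and multiple hits: as
`d ≥ 4`, it grows by more than the `5 * (d ^ (i + 1) / N)` lost. -/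
lemma layerSize_succ_le (hδ : 0 < δ) (hd : 4 ≤ d) (hN : 0 < N) (hdt : 40 * d ^ t ≤ N) {i : ℕ}
    (hi : i + 1 ≤ t) : layerSize δ d N (i + 1) ≤
      (1 - (1 / 2) ^ i / 4) * (d * layerSize δ d N i * (1 - 5 * (d ^ (i + 1) / N))) := by
  have h1 : (1 / 2 : ℝ) ^ i ≤ 1 := pow_le_one₀ (by norm_num) (by norm_num)
  have h1' : 0 < (1 / 2 : ℝ) ^ i := by positivity
  have h2 := pow_div_le_of_le hd hN hdt hi
  have h3 := pow_div_le_of_le hd hN hdt (i := i) (by omega)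
  have h4 : 4 * (d ^ i / N) ≤ d ^ (i + 1) / N := by
    rw [pow_succ', mul_div_assoc]
    exact mul_le_mul_of_nonneg_right hd (by positivity)
  have h5 : 0 ≤ d ^ i / N := by positivity
  simp only [layerSize]
  set a := d ^ i / N
  set b := d ^ (i + 1) / N
  set q := (1 / 2 : ℝ) ^ i
  rw [pow_succ (1 / 2 : ℝ) i]
  have h6 : 1 / 2 + q * (1 / 2) / 2 - 10 * b ≤ (1 - q / 4) * ((1 / 2 + q / 2 - 10 * a) * (1 - 5 * b)) := by
    have h7 : 0 ≤ q / 4 * (5 * b) := by positivity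
    have h8 : 1 - q / 4 - 5 * b ≤ (1 - q / 4) * (1 - 5 * b) := by nlinarith
    have h9 : 0 ≤ 1 / 2 + q / 2 - 10 * a := by linarith
    have h10 := mul_le_mul_of_nonneg_right h8 h9
    have h11 : (q / 4 + 5 * b) * (1 / 2 + q / 2 - 10 * a) ≤ (q / 4 + 5 * b) * 1 :=
      mul_le_mul_of_nonneg_left (by linarith) (by linarith)
    nlinarith
  have h12 : 0 ≤ δ * d ^ (i + 1) := by positivity
  have h13 := mul_le_mul_of_nonneg_left h6 h12
  calc _ = δ * d ^ (i + 1) * (1 / 2 + q * (1 / 2) / 2 - 10 * b) := by ring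
    _ ≤ _ := h13
    _ = _ := by rw [pow_succ]; ring

end layerSize

variable {V : Type*} [Fintype V] [DecidableEq V] {p : unitInterval}

/-- The exponential moment bound is kept with free `r`, since the quadratic Chernoff form is too
weak when `c` is close to 1. The `r + 1` absorbs the shift by 1 in the threshold and the one vertex
missing from the complement. -/
lemma binomialRandom_small_degree {r δ : ℝ} (hr : 0 ≤ r) (u : V) :
    (binomialRandom V p).real
      {G | ((nbrIn G {u} ({u} : Finset V)ᶜ).card : ℝ) < δ * (Fintype.card V * p) + 1} ≤
      Real.exp ((r * δ - (1 - Real.exp (-r))) * (Fintype.card V * p) + (r + 1)) := by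
  refine (binomialRandom_card_nbrIn_lt_le_exp (S := {u}) disjoint_compl_right hr _).trans
    (Real.exp_le_exp.2 ?_)
  have h1 : (({u} : Finset V)ᶜ.card : ℝ) + 1 = Fintype.card V := by
    have := Finset.card_add_card_compl ({u} : Finset V)
    rw [Finset.card_singleton] at this
    rw [← this]; push_cast; ring
  have h2 : Real.exp (-r) ≤ 1 := Real.exp_le_one_iff.2 (by linarith)
  have h3 : (0 : ℝ) ≤ p := p.2.1
  have h4 : (p : ℝ) ≤ 1 := p.2.2
  have h5 := Real.exp_pos (-r)
  rw [← h1]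
  simp only [hitProb, Finset.card_singleton, pow_one, sub_sub_cancel]
  nlinarith [mul_nonneg h3 (by linarith : 0 ≤ 1 - Real.exp (-r)),
    mul_nonneg h3 h5.le]

/-- A layer of a search grows by almost the factor `d` with high probability. -/
lemma binomialRandom_layer_step {δ d N : ℝ} {t i : ℕ} (hδ : 0 < δ) (hδ1 : δ ≤ 1 / 4) (hd : 4 ≤ d)
    (hN : 0 < N) (hdN : d = N * p) (hdt : 40 * d ^ t ≤ N) (hi : 1 ≤ i) (hit : i + 1 ≤ t)
    {S U : Finset V} (hSU : Disjoint S U) (hS : layerSize δ d N i ≤ S.card)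
    (hU : N - 4 * d ^ i ≤ U.card) :
    (binomialRandom V p).real {G | ((nbrIn G S U).card : ℝ) < layerSize δ d N (i + 1)} ≤
      Real.exp (-(δ / 1024 * d ^ 2)) := by
  have hx := pow_div_le_of_le hd hN hdt hit
  have hx0 : 0 ≤ d ^ (i + 1) / N := by positivity
  have hy := layerSize_le hδ hd hN i
  have hy' := le_layerSize hδ hd hN hdt (i := i) (by omega)
  have hsucc := layerSize_succ_le hδ hd hN hdt hit
  have hdi : 0 < d ^ i := by positivity
  set x := d ^ (i + 1) / N with hxdef
  set y := layerSize δ d N i with hydef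
  have hy0 : 0 ≤ y := le_trans (by positivity) hy'
  have hp0 : (0 : ℝ) ≤ p := p.2.1
  have hpy0 : 0 ≤ p * y := mul_nonneg hp0 hy0
  have hpx : p * d ^ i = x := by
    rw [hxdef, eq_div_iff hN.ne', pow_succ, hdN]; ring
  have hpy : p * y ≤ x := by
    rw [← hpx]
    exact mul_le_mul_of_nonneg_left (by nlinarith) hp0
  have hq := le_hitProb p hy0 hS
  have hNU : N * (1 - 4 * x) ≤ U.card := by
    have h1 : N * x = d ^ (i + 1) := by rw [hxdef, mul_div_cancel₀ _ hN.ne']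
    have h2 : d ^ i ≤ d ^ (i + 1) := pow_le_pow_right₀ (by linarith) (by omega)
    linarith
  -- The loss `4 * x` comes from explored vertices and `x / 2` from vertices hit more than once.
  have hm : d * y * (1 - 5 * x) ≤ U.card * hitProb p S.card := by
    have h1 : p * y * (1 - x / 2) ≤ hitProb p S.card := le_trans
      (mul_le_mul_of_nonneg_left (by linarith) hpy0) hq
    have h2 : 0 ≤ p * y * (1 - x / 2) := mul_nonneg hpy0 (by linarith)
    have h3 := mul_le_mul hNU h1 h2 (by positivity)
    refine le_trans ?_ h3
    have h4 : N * (1 - 4 * x) * (p * y * (1 - x / 2)) = d * y * ((1 - 4 * x) * (1 - x / 2)) := by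
      rw [hdN]; ring
    rw [h4]
    exact mul_le_mul_of_nonneg_left (by nlinarith) (by positivity)
  have h1 : (1 / 2 : ℝ) ^ i ≤ 1 := pow_le_one₀ (by norm_num) (by norm_num)
  have h1' : 0 < (1 / 2 : ℝ) ^ i := by positivity
  refine (binomialRandom_card_nbrIn_lt_le_chernoff hSU (by positivity) (by linarith) hm
    hsucc).trans (Real.exp_le_exp.2 (neg_le_neg ?_))
  have h2 : δ / 8 * d ^ (i + 1) ≤ d * y * (1 - 5 * x) := by
    have h3 : d * (δ / 4 * d ^ i) ≤ d * y := mul_le_mul_of_nonneg_left hy' (by linarith)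
    have h4 : d * y * (1 / 2) ≤ d * y * (1 - 5 * x) :=
      mul_le_mul_of_nonneg_left (by linarith) (by positivity)
    rw [pow_succ]
    linarith
  have h4 : ((1 / 2 : ℝ) ^ i / 4) ^ 2 * 4 ^ i = 1 / 16 := by
    rw [div_pow, ← pow_mul, mul_comm i 2, pow_mul, div_mul_eq_mul_div, ← mul_pow]
    norm_num
  -- The squared deviation shrinks like `4 ^ (-i)`, but the mean grows like `d ^ (i + 1)`; with `d ≥
  -- 4` and `i ≥ 1` the weakest layer is `i = 1`, of order `d ^ 2`.
  have h6 : (4 : ℝ) ^ i * d ≤ 4 * d ^ i := by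
    obtain ⟨j, rfl⟩ : ∃ j, i = j + 1 := ⟨i - 1, by omega⟩
    have h4 : (4 : ℝ) ^ j ≤ d ^ j := pow_le_pow_left₀ (by norm_num) hd j
    rw [pow_succ, pow_succ]
    nlinarith
  calc δ / 1024 * d ^ 2 ≤ δ / 64 * d ^ 2 * (((1 / 2 : ℝ) ^ i / 4) ^ 2 * 4 ^ i) := by
        rw [h4]; nlinarith [mul_pos hδ (by positivity : 0 < d ^ 2)]
    _ = ((1 / 2 : ℝ) ^ i / 4) ^ 2 * (δ / 64 * (4 ^ i * d) * d) := by ring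
    _ ≤ ((1 / 2 : ℝ) ^ i / 4) ^ 2 * (δ / 64 * (4 * d ^ i) * d) := by gcongr
    _ = ((1 / 2 : ℝ) ^ i / 4) ^ 2 * (δ / 8 * d ^ (i + 1)) / 2 := by rw [pow_succ]; ring
    _ ≤ _ := by gcongr

/-- A search reaches a layer of size about `d ^ t`, as long as `d ^ t` is small. -/
lemma binomialRandom_not_joins_layers {δ d N B : ℝ} {t j : ℕ} (hδ : 0 < δ) (hδ1 : δ ≤ 1 / 4)
    (hd : 4 ≤ d) (hN : 0 < N) (hdN : d = N * p) (hdt : 40 * d ^ t ≤ N) (ht : 1 ≤ t) (hB : 0 ≤ B)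
    {S U T : Finset V}
    (hend : ∀ S U : Finset V, Disjoint S U → Disjoint S T → Disjoint U T →
      δ / 4 * d ^ t ≤ S.card → N / 2 ≤ U.card →
      (binomialRandom V p).real {G | ¬ Joins G U T j S} ≤ B)
    (hSU : Disjoint S U) (hST : Disjoint S T) (hUT : Disjoint U T)
    (hS : δ * d ≤ S.card) (hU : N - 4 * d ≤ U.card) :
    (binomialRandom V p).real {G | ¬ Joins G U T (j + (t - 1)) S} ≤
      t * Real.exp (-(δ / 1024 * d ^ 2)) + B := by
  have hy0 : ∀ l, l ≤ t → 0 ≤ layerSize δ d N l := fun l hl =>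
    le_trans (by positivity) (le_layerSize hδ hd hN hdt hl)
  have h := binomialRandom_not_joins_add (p := p) (T := T) (y := layerSize δ d N)
    -- Layers grow geometrically, so `4 * d ^ l` covers all vertices used up to layer `l`. Starting
    -- at layer 1, `t - 1` exposures reach layer `t`.
    (m := fun l => N - 4 * d ^ l) (β := Real.exp (-(δ / 1024 * d ^ 2))) (B := B)
    (Real.exp_pos _).le hB j (t - 1) 1 (fun l h1 h2 => hy0 _ (by omega))
    (fun l h1 h2 => by
      have h3 := layerSize_le hδ hd hN (l + 1)
      have h4 : (1 : ℝ) ≤ d ^ l := one_le_pow₀ (by linarith)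
      have h5 : 4 * d ^ l ≤ d ^ (l + 1) := by rw [pow_succ']; gcongr
      have h6 : δ * d ^ (l + 1) ≤ 1 / 4 * d ^ (l + 1) := by gcongr
      linarith)
    (fun l h1 h2 S U hSU hS hU =>
      binomialRandom_layer_step hδ hδ1 hd hN hdN hdt h1 (by omega) hSU hS hU)
    (fun S U h1 h2 h3 h4 h5 => by
      rw [show 1 + (t - 1) = t by omega] at h4 h5
      exact hend S U h1 h2 h3 ((le_layerSize hδ hd hN hdt le_rfl).trans h4) (by linarith))
    hSU hST hUT (((layerSize_le hδ hd hN 1).trans (by rw [pow_one])).trans hS) (by simpa using hU)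
  refine h.trans ?_
  have : ((t - 1 : ℕ) : ℝ) ≤ t := by exact_mod_cast Nat.sub_le t 1
  gcongr

lemma binomialRandom_not_joins_caseTwo {δ d N L : ℝ} {t : ℕ} (hδ : 0 < δ) (hδ1 : δ ≤ 1 / 4)
    (hd : 4 ≤ d) (hN : 0 < N) (hdN : d = N * p) (hdt : 40 * d ^ t ≤ N) (ht : 1 ≤ t)
    (hL1 : L ≤ δ / 1024 * d ^ 2) (hL2 : L ≤ δ ^ 2 / 4 * (d * (d ^ (t + 1) / N)))
    {S U T : Finset V} (hSU : Disjoint S U) (hST : Disjoint S T) (hUT : Disjoint U T)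
    (hS : δ * d ≤ S.card) (hT : δ * d ≤ T.card) (hU : N - 4 * d ≤ U.card) :
    (binomialRandom V p).real {G | ¬ Joins G U T (t - 1) S} ≤ (t + 2) * Real.exp (-L) := by
  have hp0 : (0 : ℝ) ≤ p := p.2.1
  have h := binomialRandom_not_joins_layers (j := 0) hδ hδ1 hd hN hdN hdt ht (Real.exp_pos (-L)).le
    (fun S U h1 h2 h3 h4 h5 => (binomialRandom_not_joins_zero h2).trans (Real.exp_le_exp.2
      (neg_le_neg (hL2.trans ?_)))) hSU hST hUT hS hU
  · rw [zero_add] at h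
    refine h.trans ?_
    have : Real.exp (-(δ / 1024 * d ^ 2)) ≤ Real.exp (-L) := Real.exp_le_exp.2 (neg_le_neg hL1)
    have h2 := Real.exp_pos (-L)
    have h3 : (t : ℝ) * Real.exp (-(δ / 1024 * d ^ 2)) ≤ t * Real.exp (-L) := by gcongr
    linarith
  -- The expected number of edges between the last layer and `T` is at least `δ ^ 2 / 4` times `d
  -- γ`.
  · calc δ ^ 2 / 4 * (d * (d ^ (t + 1) / N)) = p * (δ / 4 * d ^ t) * (δ * d) := by
          have : d ^ (t + 1) / N = p * d ^ t := by
            rw [div_eq_iff hN.ne', pow_succ]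
            nth_rewrite 2 [hdN]
            ring
          rw [this]; ring
      _ ≤ _ := by gcongr

lemma binomialRandom_not_joins_caseOne {δ ρ d N L : ℝ} {t : ℕ} (hδ : 0 < δ) (hδ1 : δ ≤ 1 / 4)
    (hρ : 0 < ρ) (hρδ : ρ ≤ δ / 4) (hd : 4 ≤ d) (hN : 0 < N) (hdN : d = N * p)
    (hdt : 40 * d ^ t ≤ N) (hγ : ρ * (d ^ (t + 1) / N) ≤ 1)
    (hL1 : L ≤ ρ / 1024 * d ^ 2) (hL2 : L ≤ ρ * δ / 8 * (d ^ 2 * (d ^ (t + 1) / N)))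
    {S U T : Finset V} (hSU : Disjoint S U) (hST : Disjoint S T) (hUT : Disjoint U T)
    (hS : δ * d ≤ S.card) (hT : δ * d ≤ T.card) (hU : N - 4 * d ≤ U.card) :
    (binomialRandom V p).real {G | ¬ Joins G U T t S} ≤ (t + 2) * Real.exp (-L) := by
  have hp0 : (0 : ℝ) ≤ p := p.2.1
  have hpd : d ^ (t + 1) / N = p * d ^ t := by
    rw [div_eq_iff hN.ne', pow_succ]
    nth_rewrite 2 [hdN]
    ring
  have hLpos := Real.exp_pos (-L)
  -- For `t = 0` no layer is grown: `S` and `T` are joined directly, with about `p * (δ d) ^ 2`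
  -- expected edges.
  rcases Nat.eq_zero_or_pos t with rfl | ht
  · refine (binomialRandom_not_joins_zero hST).trans ?_
    have h1 : Real.exp (-(p * S.card * T.card)) ≤ Real.exp (-L) := by
      refine Real.exp_le_exp.2 (neg_le_neg (hL2.trans ?_))
      rw [hpd]
      calc ρ * δ / 8 * (d ^ 2 * (p * d ^ 0)) ≤ (δ / 4) * δ / 8 * (d ^ 2 * (p * d ^ 0)) := by gcongr
        _ ≤ 32 * ((δ / 4) * δ / 8 * (d ^ 2 * (p * d ^ 0))) :=
          le_mul_of_one_le_left (by positivity) (by norm_num)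
        _ = p * (δ * d) * (δ * d) := by ring
        _ ≤ _ := by gcongr
    push_cast
    linarith
  · have hend : ∀ S U : Finset V, Disjoint S U → Disjoint S T → Disjoint U T →
        δ / 4 * d ^ t ≤ S.card → N / 2 ≤ U.card →
        (binomialRandom V p).real {G | ¬ Joins G U T 1 S} ≤ Real.exp (-L) + Real.exp (-L) := by
      intro S U h1 h2 h3 h4 h5
      -- Only `ρ * d ^ t` vertices are counted: then `p * ρ * d ^ t = ρ γ ≤ 1`, and `hitProb` is at
      -- least half its linear approximation, even though `p * d ^ t` itself may be large.
      have hy : ρ * d ^ t ≤ S.card := le_trans (by gcongr) h4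
      have hq := le_hitProb p (by positivity) hy
      have hpy : p * (ρ * d ^ t) ≤ 1 := by rw [hpd] at hγ; linarith
      have hm : ρ / 4 * d ^ (t + 1) ≤ U.card * hitProb p S.card := by
        have h6 : p * (ρ * d ^ t) * (1 / 2) ≤ hitProb p S.card :=
          le_trans (mul_le_mul_of_nonneg_left (by linarith) (by positivity)) hq
        refine le_trans (le_of_eq ?_) (mul_le_mul h5 h6 (by positivity) (by positivity))
        rw [pow_succ]
        nth_rewrite 2 [hdN]
        ring
      have hstep := binomialRandom_card_nbrIn_lt_le_chernoff (p := p) h1 (η := 1 / 2)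
        (y := ρ / 8 * d ^ (t + 1)) (by norm_num) (by norm_num) hm (by linarith)
      refine binomialRandom_not_joins_succ (k := 0) h1 h2 hLpos.le
        (hstep.trans (Real.exp_le_exp.2 (neg_le_neg (hL1.trans ?_)))) fun S' hS'U hS' =>
        (binomialRandom_not_joins_zero (h3.mono_left hS'U)).trans
          (Real.exp_le_exp.2 (neg_le_neg (hL2.trans ?_)))
      · have h6 : d ^ 2 ≤ d ^ (t + 1) := pow_le_pow_right₀ (by linarith) (by omega)
        have h7 : ρ * d ^ 2 ≤ ρ * d ^ (t + 1) := by gcongr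
        have h8 : 0 ≤ ρ * d ^ 2 := by positivity
        linarith
      · have h6 : ρ / 8 * d ^ (t + 1) ≤ S'.card := by rw [hS']; exact Nat.le_ceil _
        calc ρ * δ / 8 * (d ^ 2 * (d ^ (t + 1) / N)) = p * (ρ / 8 * d ^ (t + 1)) * (δ * d) := by
              rw [hpd, pow_succ]; ring
          _ ≤ _ := by gcongr
    have h := binomialRandom_not_joins_layers (j := 1) hδ hδ1 hd hN hdN hdt ht (by positivity) hend
      hSU hST hUT hS hU
    rw [show 1 + (t - 1) = t by omega] at h
    refine h.trans ?_
    have : Real.exp (-(δ / 1024 * d ^ 2)) ≤ Real.exp (-L) := by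
      refine Real.exp_le_exp.2 (neg_le_neg (hL1.trans ?_))
      have : ρ ≤ δ := by linarith
      gcongr
    have h3 : (t : ℝ) * Real.exp (-(δ / 1024 * d ^ 2)) ≤ t * Real.exp (-L) := by gcongr
    linarith

/-- Sizes of the parts after exposing the neighbourhoods of two vertices. -/
lemma card_sdiff_pair_ge {δ d N : ℝ} (hN : N = Fintype.card V) (hδ : 0 < δ) (hδ1 : δ ≤ 1 / 4)
    (hd : 4 ≤ d) (u v : V) {S T : Finset V} (hS : S.card = ⌈δ * d⌉₊) (hT : T.card = ⌈δ * d⌉₊) :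
    N - 4 * d ≤ (((({u, v} : Finset V)ᶜ \ S) \ T).card : ℝ) := by
  have h1 := Finset.le_card_sdiff S ({u, v} : Finset V)ᶜ
  have h2 := Finset.le_card_sdiff T (({u, v} : Finset V)ᶜ \ S)
  have h3 := Finset.card_add_card_compl ({u, v} : Finset V)
  have h4 : ({u, v} : Finset V).card ≤ 2 := Finset.card_le_two
  have h5 : Fintype.card V ≤ ((({u, v} : Finset V)ᶜ \ S) \ T).card + S.card + T.card + 2 := by omega
  have h6 : (Fintype.card V : ℝ) ≤ ((({u, v} : Finset V)ᶜ \ S) \ T).card + S.card + T.card + 2 := by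
    exact_mod_cast h5
  have h7 := Nat.ceil_lt_add_one (show 0 ≤ δ * d by positivity)
  rw [hS, hT] at h6
  nlinarith

lemma binomialRandom_not_ediam_le_of_joins {r δ d N L : ℝ} {t k : ℕ} (hN : N = Fintype.card V)
    (hr : 0 ≤ r) (hδ : 0 < δ) (hδ1 : δ ≤ 1 / 4) (hd : 4 ≤ d) (hdN : d = N * p)
    (h : ∀ S U T : Finset V, Disjoint S U → Disjoint S T → Disjoint U T → δ * d ≤ S.card →
      δ * d ≤ T.card → N - 4 * d ≤ U.card →
      (binomialRandom V p).real {G | ¬ Joins G U T k S} ≤ (t + 2) * Real.exp (-L)) :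
    (binomialRandom V p).real {G | ¬ G.ediam ≤ (k : ℕ∞) + 3} ≤
      N * Real.exp ((r * δ - (1 - Real.exp (-r))) * d + (r + 1)) +
        N ^ 2 * ((t + 2) * Real.exp (-L)) := by
  subst hN hdN
  refine binomialRandom_not_ediam_le (y := δ * (Fintype.card V * p)) (by positivity)
    (fun u => binomialRandom_small_degree hr u) fun u v _ S _ T _ hdST hS hT =>
    h S _ T ?_ hdST Finset.sdiff_disjoint ?_ ?_ (card_sdiff_pair_ge rfl hδ hδ1 hd u v hS hT)
  · exact Finset.disjoint_sdiff.mono_right Finset.sdiff_subset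
  · rw [hS]; exact Nat.le_ceil _
  · rw [hT]; exact Nat.le_ceil _

end

/-! ### Passing to the limit -/

section

lemma holdsWhp_of_le {l : Filter ℕ} {p : ℕ → unitInterval}
    {E : (n : ℕ) → SimpleGraph (Fin n) → Prop} {b : ℕ → ℝ}
    (h : ∀ᶠ n in l, (binomialRandom (Fin n) (p n)).real {G | ¬ E n G} ≤ b n)
    (hb : Tendsto b l (𝓝 0)) : HoldsWhp l p E := by
  have h1 : Tendsto (fun n => (binomialRandom (Fin n) (p n)).real {G | E n G}) l (𝓝 1) := by
    have h2 : Tendsto (fun n => 1 - b n) l (𝓝 1) := by simpa using hb.const_sub 1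
    refine tendsto_of_tendsto_of_tendsto_of_le_of_le' h2 tendsto_const_nhds ?_
      (.of_forall fun n => measureReal_le_one)
    filter_upwards [h] with n hn
    have h3 := probReal_compl_eq_one_sub (μ := binomialRandom (Fin n) (p n)) (s := {G | E n G})
      (.of_discrete)
    have h4 : {G | E n G}ᶜ = {G | ¬ E n G} := rfl
    rw [h4] at h3
    linarith
  have h2 := ENNReal.tendsto_ofReal h1
  simpa [HoldsWhp, ofReal_measureReal] using h2

lemma _root_.HoldsWhp.and {l : Filter ℕ} {p : ℕ → unitInterval}
    {E E' : (n : ℕ) → SimpleGraph (Fin n) → Prop} (h : HoldsWhp l p E) (h' : HoldsWhp l p E') :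
    HoldsWhp l p fun n G => E n G ∧ E' n G := by
  have key : ∀ {E : (n : ℕ) → SimpleGraph (Fin n) → Prop}, HoldsWhp l p E →
      Tendsto (fun n => (binomialRandom (Fin n) (p n)).real {G | ¬ E n G}) l (𝓝 0) := by
    intro E h
    have h1 := (ENNReal.tendsto_toReal ENNReal.one_ne_top).comp h
    have h2 := h1.const_sub 1
    simp only [ENNReal.toReal_one, sub_self] at h2
    refine h2.congr fun n => ?_
    exact (probReal_compl_eq_one_sub (μ := binomialRandom (Fin n) (p n)) (s := {G | E n G})
      (.of_discrete)).symm
  refine holdsWhp_of_le (.of_forall fun n => ?_) (by simpa using (key h).add (key h'))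
  refine (measureReal_mono ?_).trans (measureReal_union_le _ _)
  intro G hG
  exact not_and_or.1 hG

lemma _root_.HoldsWhp.mono {l : Filter ℕ} {p : ℕ → unitInterval}
    {E E' : (n : ℕ) → SimpleGraph (Fin n) → Prop} (h : HoldsWhp l p E)
    (hE : ∀ n G, E n G → E' n G) : HoldsWhp l p E' :=
  tendsto_of_tendsto_of_tendsto_of_le_of_le h tendsto_const_nhds
    (fun n => measure_mono fun G hG => hE n G hG) fun _ => prob_le_one

/-! ### Consequences of the maximality of `t*` -/

section TStar

variable {S : Set ℕ} {d : ℕ → ℝ} {t : ℕ → ℕ}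

lemma tendsto_log_nToInfinityIn :
    Tendsto (fun n : ℕ => Real.log n) (nToInfinityIn S) atTop :=
  (Real.tendsto_log_atTop.comp tendsto_natCast_atTop_atTop).mono_left inf_le_left

lemma eventually_mem_nToInfinityIn : ∀ᶠ n in nToInfinityIn S, n ∈ S :=
  mem_inf_of_right (mem_principal_self S)

lemma eventually_gt_nToInfinityIn (m : ℕ) : ∀ᶠ n in nToInfinityIn S, m < n :=
  (eventually_gt_atTop m).filter_mono inf_le_left

lemma _root_.IsTStar.tendsto (ht : IsTStar (nToInfinityIn S) d t) :
    Tendsto (fun n => d n ^ t n / n) (nToInfinityIn S) (𝓝 0) :=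
  ht.isLittleO.tendsto_div_nhds_zero

/-- Otherwise `γ → 0` along some sequence in `S`. Raising `t` by one along that sequence alone keeps
`d ^ s = o(n)`, contradicting maximality. -/
lemma _root_.IsTStar.exists_le_gammaOf (hd0 : ∀ᶠ n in nToInfinityIn S, 0 ≤ d n)
    (ht : IsTStar (nToInfinityIn S) d t) :
    ∃ ε > 0, ∀ᶠ n in nToInfinityIn S, ε ≤ gammaOf d t n := by
  by_contra hcon
  push Not at hcon
  have h1 : ∀ k : ℕ, ∃ᶠ n in atTop, n ∈ S ∧ gammaOf d t n < 1 / ((k : ℝ) + 1) := by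
    intro k
    have := hcon (1 / ((k : ℝ) + 1)) (by positivity)
    rwa [nToInfinityIn, frequently_inf_principal] at this
  obtain ⟨φ, hφ, hφS⟩ := extraction_forall_of_frequently h1
  -- The competitor `s` equals `t + 1` on the range of `φ`, where `γ (φ k) < 1 / (k + 1)`, and `t`
  -- elsewhere.
  classical
  have h2 := ht.largest (fun n => if n ∈ Set.range φ then t n + 1 else t n) (by
    rw [isLittleO_iff]
    intro ε hε
    obtain ⟨K, hK⟩ := exists_nat_one_div_lt hε
    filter_upwards [isLittleO_iff.1 ht.isLittleO hε, hd0, eventually_gt_nToInfinityIn (φ K)]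
      with n hn hdn hKn
    split_ifs with hr
    · obtain ⟨k, rfl⟩ := hr
      have hKk : K ≤ k := (hφ.lt_iff_lt.1 hKn).le
      have hpos : (0 : ℝ) < (φ k : ℕ) := by exact_mod_cast (Nat.zero_le _).trans_lt hKn
      have h3 : gammaOf d t (φ k) ≤ ε := by
        refine (hφS k).2.le.trans (le_trans ?_ hK.le)
        exact one_div_le_one_div_of_le (by positivity) (by exact_mod_cast Nat.succ_le_succ hKk)
      rw [gammaOf, div_le_iff₀ hpos] at h3
      rwa [Real.norm_of_nonneg (by positivity), Real.norm_of_nonneg hpos.le]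
    · exact hn)
  rw [nToInfinityIn, eventually_inf_principal, eventually_atTop] at h2
  obtain ⟨m, hm⟩ := h2
  have h3 := hm (φ m) (hφ.id_le m) (hφS m).1
  simp at h3

end TStar

/-! ### The diameter bounds w.h.p. -/

section Main

variable {S : Set ℕ} {d : ℕ → ℝ} {p : ℕ → unitInterval} {c : ℝ} {t : ℕ → ℕ}

lemma eventually_degree (hp : ∀ n ∈ S, (p n : ℝ) = d n / n) (hc : 1 < c)
    (hd : ∀ n ∈ S, c * Real.log n ≤ d n) (m : ℝ) :
    ∀ᶠ n in nToInfinityIn S, 2 < n ∧ d n = n * p n ∧ c * Real.log n ≤ d n ∧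
      Real.log n ≤ d n ∧ m ≤ Real.log n := by
  filter_upwards [eventually_mem_nToInfinityIn, eventually_gt_nToInfinityIn 2,
    tendsto_log_nToInfinityIn.eventually_ge_atTop m,
    tendsto_log_nToInfinityIn.eventually_ge_atTop 0] with n hS hn hm h0
  have hn0 : (n : ℝ) ≠ 0 := by positivity
  refine ⟨hn, ?_, hd n hS, le_trans (by nlinarith) (hd n hS), hm⟩
  rw [hp n hS, mul_div_cancel₀ _ hn0]

theorem holdsWhp_le_ediam (hp : ∀ n ∈ S, (p n : ℝ) = d n / n) (hc : 1 < c)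
    (hd : ∀ n ∈ S, c * Real.log n ≤ d n) (ht : IsTStar (nToInfinityIn S) d t) :
    HoldsWhp (nToInfinityIn S) p (fun n G => (t n : ℕ∞) ≤ G.ediam) := by
  refine holdsWhp_of_le ?_ ht.tendsto
  filter_upwards [eventually_degree hp hc hd 2] with n ⟨hn, hdn, _, hlog, h2⟩
  have hn0 : (0 : ℝ) < n := by positivity
  have hd2 : 2 ≤ d n := h2.trans hlog
  rcases Nat.eq_zero_or_pos (t n) with h0 | h0
  · simp only [h0, Nat.cast_zero, zero_le, not_true_eq_false]
    simp
  obtain ⟨m, hm⟩ : ∃ m, t n = m + 1 := ⟨t n - 1, by omega⟩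
  let u : Fin n := ⟨0, by omega⟩
  let v : Fin n := ⟨1, by omega⟩
  have huv : u ≠ v := by simp [u, v]
  have hsub : {G : SimpleGraph (Fin n) | ¬ (t n : ℕ∞) ≤ G.ediam} ⊆
      {G | G.edist u v ≤ (m : ℕ∞)} := by
    intro G hG
    simp only [Set.mem_ofPred_eq, not_le, hm] at hG ⊢
    push_cast at hG
    exact edist_le_ediam.trans (Order.le_of_lt_add_one hG)
  -- As `d ≥ 2`, the longest paths dominate the count.
  have hsum : ∀ k, ∑ i ∈ Finset.range k, d n ^ i ≤ d n ^ k := by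
    intro k
    induction k with
    | zero => simp
    | succ k ih =>
      rw [Finset.sum_range_succ, pow_succ]
      nlinarith [pow_pos (by linarith : 0 < d n) k]
  calc _ ≤ _ := measureReal_mono hsub
    _ ≤ _ := binomialRandom_edist_le huv m
    _ = p n * ∑ i ∈ Finset.range m, d n ^ i := by
      rw [Fintype.card_fin, ← hdn, Finset.mul_sum]
    _ ≤ p n * d n ^ m := mul_le_mul_of_nonneg_left (hsum m) (p n).2.1
    _ = d n ^ t n / n := by
      rw [hm, eq_div_iff hn0.ne', pow_succ]
      nth_rewrite 3 [hdn]
      ring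

/-- Union bound over all pairs of vertices, in the limit. -/
lemma holdsWhp_ediam_le_of_joins {r δ : ℝ} (hp : ∀ n ∈ S, (p n : ℝ) = d n / n) (hc : 1 < c)
    (hd : ∀ n ∈ S, c * Real.log n ≤ d n) (ht : IsTStar (nToInfinityIn S) d t) (hr : 0 < r)
    (hδ : 0 < δ) (hδ1 : δ ≤ 1 / 4) (hrδ : r * δ - (1 - Real.exp (-r)) ≤ -((c + 1) / (2 * c)))
    {k : ℕ → ℕ}
    (h : ∀ᶠ n in nToInfinityIn S, ∀ S U T : Finset (Fin n), Disjoint S U → Disjoint S T →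
      Disjoint U T → δ * d n ≤ S.card → δ * d n ≤ T.card → n - 4 * d n ≤ U.card →
      (binomialRandom (Fin n) (p n)).real {G | ¬ Joins G U T (k n) S} ≤
        (t n + 2) * Real.exp (-(4 * Real.log n))) :
    HoldsWhp (nToInfinityIn S) p (fun n G => G.ediam ≤ (k n : ℕ∞) + 3) := by
  -- The first term bounds `n * n ^ (-(c + 1) / 2)`, up to a constant, from small degrees; the
  -- second bounds `n ^ 2 * (t + 2) * n ^ (-4) ≤ 2 / n` from the pairs.
  have hlim : Tendsto (fun n : ℕ => Real.exp ((r + 1) - (c - 1) / 2 * Real.log n) +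
      2 * Real.exp (-Real.log n)) (nToInfinityIn S) (𝓝 0) := by
    have h1 : Tendsto (fun n : ℕ => Real.exp (-Real.log n)) (nToInfinityIn S) (𝓝 0) :=
      Real.tendsto_exp_neg_atTop_nhds_zero.comp tendsto_log_nToInfinityIn
    have h2 : Tendsto (fun n : ℕ => Real.exp (-((c - 1) / 2 * Real.log n)))
        (nToInfinityIn S) (𝓝 0) :=
      Real.tendsto_exp_neg_atTop_nhds_zero.comp
        (tendsto_log_nToInfinityIn.const_mul_atTop (by linarith))
    have h3 := (h2.const_mul (Real.exp (r + 1))).add (h1.const_mul 2)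
    simp only [mul_zero, add_zero, ← Real.exp_add, ← sub_eq_add_neg] at h3
    exact h3
  refine holdsWhp_of_le ?_ hlim
  filter_upwards [h, eventually_degree hp hc hd 4,
    ht.tendsto.eventually_le_const (show (0 : ℝ) < 1 by norm_num)]
    with n hn ⟨hn2, hdn, hcd, hlog, h4⟩ htn
  have hn0 : (0 : ℝ) < n := by positivity
  have hd4 : 4 ≤ d n := h4.trans hlog
  refine (binomialRandom_not_ediam_le_of_joins (N := n) (d := d n) (by simp) hr.le hδ hδ1 hd4 hdn
    hn).trans (add_le_add ?_ ?_)
  · nth_rewrite 1 [← Real.exp_log hn0]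
    rw [← Real.exp_add]
    refine Real.exp_le_exp.2 ?_
    have h1 : (r * δ - (1 - Real.exp (-r))) * d n ≤ -((c + 1) / (2 * c)) * (c * Real.log n) :=
      calc _ ≤ -((c + 1) / (2 * c)) * d n := mul_le_mul_of_nonneg_right hrδ (by linarith)
        _ ≤ _ := mul_le_mul_of_nonpos_left hcd
          (neg_nonpos.2 (div_nonneg (by linarith) (by linarith)))
    have h2 : -((c + 1) / (2 * c)) * (c * Real.log n) = -((c + 1) / 2 * Real.log n) := by
      have : c ≠ 0 := by linarith
      field_simp
    linarith
  -- Crudely, `t ≤ 2 ^ t ≤ d ^ t ≤ n`.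
  · have h1 : (t n : ℝ) ≤ n := by
      rw [div_le_one hn0] at htn
      have h2 : ((t n : ℕ) : ℝ) ≤ 2 ^ t n := by exact_mod_cast Nat.lt_two_pow_self.le
      exact h2.trans ((pow_le_pow_left₀ (by norm_num) (by linarith) _).trans htn)
    have h2 : (2 : ℝ) ≤ n := by exact_mod_cast hn2.le
    have h3 : Real.exp (-Real.log n) = (n : ℝ)⁻¹ := by rw [Real.exp_neg, Real.exp_log hn0]
    have h5 : Real.exp (-(4 * Real.log n)) = ((n : ℝ)⁻¹) ^ 4 := by
      rw [← h3, ← Real.exp_nat_mul]; push_cast; ring_nf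
    rw [h3, h5]
    calc (n : ℝ) ^ 2 * ((t n + 2) * (n : ℝ)⁻¹ ^ 4) ≤ (n : ℝ) ^ 2 * ((n + n) * (n : ℝ)⁻¹ ^ 4) := by
          gcongr
      _ = _ := by field_simp; ring

theorem holdsWhp_ediam_le_caseTwo (hp : ∀ n ∈ S, (p n : ℝ) = d n / n) (hc : 1 < c)
    (hd : ∀ n ∈ S, c * Real.log n ≤ d n) (ht : IsTStar (nToInfinityIn S) d t)
    (h2 : CaseTwo (nToInfinityIn S) d t) :
    HoldsWhp (nToInfinityIn S) p (fun n G => G.ediam ≤ (t n : ℕ∞) + 2) := by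
  obtain ⟨r, δ, hr, hδ, hδ1, hrδ⟩ := exists_degree_constants hc
  -- If `t n = 0`, then `γ = d / n = p ≤ 1`, which is eventually excluded.
  have hpos : ∀ᶠ n in nToInfinityIn S, 1 ≤ t n := by
    filter_upwards [eventually_degree hp hc hd 0, h2.eventually_gt_atTop 1] with n ⟨hn, hdn, _⟩ hγ
    by_contra h0
    have hn0 : (0 : ℝ) < n := by positivity
    rw [gammaOf, show t n = 0 by omega, zero_add, pow_one, hdn, mul_div_cancel_left₀ _ hn0.ne'] at hγ
    linarith [(p n).2.2]
  have h := holdsWhp_ediam_le_of_joins (k := fun n => t n - 1) hp hc hd ht hr hδ hδ1 hrδ (by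
    -- The thresholds `4096 / δ` and `16 / δ ^ 2` make both exponents at least `4 * log n`.
    filter_upwards [hpos, eventually_degree hp hc hd (4 + 4096 / δ),
      h2.eventually_ge_atTop (16 / δ ^ 2),
      ht.tendsto.eventually_le_const (show (0 : ℝ) < 1 / 40 by norm_num)]
      with n h1 ⟨hn, hdn, _, hlog, hlog'⟩ hγ htn S U T hSU hST hUT hS hT hU
    have hn0 : (0 : ℝ) < n := by positivity
    have hδ' : 0 < 4096 / δ := by positivity
    have hγ' : 0 ≤ 16 / δ ^ 2 := by positivity
    refine binomialRandom_not_joins_caseTwo hδ hδ1 (by linarith) hn0 hdn ?_ h1 ?_ ?_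
      hSU hST hUT hS hT hU
    · rw [div_le_iff₀ hn0] at htn; linarith
    · have h3 : 4096 / δ * Real.log n ≤ d n ^ 2 := by
        rw [sq]; exact mul_le_mul (by linarith) hlog (by linarith) (by linarith)
      calc 4 * Real.log n = δ / 1024 * (4096 / δ * Real.log n) := by field_simp; ring
        _ ≤ _ := by gcongr
    · have h3 : Real.log n * (16 / δ ^ 2) ≤ d n * gammaOf d t n :=
        mul_le_mul hlog hγ hγ' (by linarith)
      calc 4 * Real.log n = δ ^ 2 / 4 * (Real.log n * (16 / δ ^ 2)) := by field_simp; ring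
        _ ≤ _ := mul_le_mul_of_nonneg_left h3 (by positivity))
  -- The truncated `t n - 1` is a true predecessor once `t n ≥ 1`, so `(t n - 1) + 3 = t n + 2`.
  refine Tendsto.congr' ?_ h
  filter_upwards [hpos] with n hn
  obtain ⟨m, hm⟩ : ∃ m, t n = m + 1 := ⟨t n - 1, by omega⟩
  have : ((t n - 1 : ℕ) : ℕ∞) + 3 = (t n : ℕ∞) + 2 := by
    rw [hm, Nat.add_sub_cancel]; push_cast; rw [add_assoc]; norm_num
  simp only [this]

theorem holdsWhp_ediam_le_caseOne (hp : ∀ n ∈ S, (p n : ℝ) = d n / n) (hc : 1 < c)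
    (hd : ∀ n ∈ S, c * Real.log n ≤ d n) (ht : IsTStar (nToInfinityIn S) d t)
    (h1 : CaseOne (nToInfinityIn S) d t) :
    HoldsWhp (nToInfinityIn S) p (fun n G => G.ediam ≤ (t n : ℕ∞) + 3) := by
  obtain ⟨r, δ, hr, hδ, hδ1, hrδ⟩ := exists_degree_constants hc
  obtain ⟨C, hC, hγC⟩ := h1.exists_pos
  obtain ⟨ε, hε, hγε⟩ := ht.exists_le_gammaOf (by
    filter_upwards [eventually_degree hp hc hd 0] with n ⟨_, _, _, h3, h4⟩
    linarith)
  -- The bound `1 / C` ensures `ρ γ ≤ 1`; the bound `δ / 4` keeps `ρ * d ^ t` below the size of the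
  -- layer reached.
  set ρ := min (δ / 4) (1 / C) with hρdef
  have hρ : 0 < ρ := by positivity
  refine holdsWhp_ediam_le_of_joins (k := t) hp hc hd ht hr hδ hδ1 hrδ ?_
  filter_upwards [eventually_degree hp hc hd (4 + 4096 / ρ + 32 / (ρ * δ * ε)),
    hγC.bound, hγε,
    ht.tendsto.eventually_le_const (show (0 : ℝ) < 1 / 40 by norm_num)]
    with n ⟨hn, hdn, _, hlog, hlog'⟩ hγC hγε htn S U T hSU hST hUT hS hT hU
  have hn0 : (0 : ℝ) < n := by positivity
  have h2 : 0 < 4096 / ρ := by positivity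
  have h3 : 0 < 32 / (ρ * δ * ε) := by positivity
  refine binomialRandom_not_joins_caseOne hδ hδ1 hρ (min_le_left _ _) (by linarith) hn0 hdn ?_ ?_
    ?_ ?_ hSU hST hUT hS hT hU
  · rw [div_le_iff₀ hn0] at htn; linarith
  · rw [norm_one, mul_one, Real.norm_eq_abs] at hγC
    calc ρ * (d n ^ (t n + 1) / n) ≤ 1 / C * C :=
          mul_le_mul (min_le_right _ _) ((le_abs_self _).trans hγC) (hε.le.trans hγε)
            (by positivity)
      _ = 1 := by field_simp
  · have h4 : 4096 / ρ * Real.log n ≤ d n ^ 2 := by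
      rw [sq]; exact mul_le_mul (by linarith) hlog (by linarith) (by linarith)
    calc 4 * Real.log n = ρ / 1024 * (4096 / ρ * Real.log n) := by field_simp; ring
      _ ≤ _ := by gcongr
  · have h4 : 32 / (ρ * δ * ε) * Real.log n ≤ d n ^ 2 := by
      rw [sq]; exact mul_le_mul (by linarith) hlog (by linarith) (by linarith)
    have h5 : 32 / (ρ * δ * ε) * Real.log n * ε ≤ d n ^ 2 * gammaOf d t n :=
      mul_le_mul h4 hγε hε.le (by positivity)
    calc 4 * Real.log n = ρ * δ / 8 * (32 / (ρ * δ * ε) * Real.log n * ε) := by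
          field_simp; ring
      _ ≤ _ := mul_le_mul_of_nonneg_left h5 (by positivity)

lemma mem_window {x : ℕ∞} {t : ℕ} (h : (t : ℕ∞) ≤ x) (h' : x ≤ (t : ℕ∞) + 3) :
    x ∈ ({(t : ℕ∞), (t : ℕ∞) + 1, (t : ℕ∞) + 2, (t : ℕ∞) + 3} : Set ℕ∞) := by
  have hx : x ≠ ⊤ := ne_top_of_le_ne_top (by exact_mod_cast ENat.natCast_ne_top (t + 3)) h'
  lift x to ℕ using hx
  norm_cast at h h'
  have : x = t ∨ x = t + 1 ∨ x = t + 2 ∨ x = t + 3 := by omega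
  rcases this with rfl | rfl | rfl | rfl <;> simp

end Main

end

end BinomialRandomGraph

open BinomialRandomGraph in
theorem mainTheorem4 (S : Set ℕ) (hS : S.Infinite) (d : ℕ → ℝ) (p : ℕ → unitInterval)
    (hp : ∀ n ∈ S, (p n : ℝ) = d n / n) (c : ℝ) (hc : 1 < c)
    (hd : ∀ n ∈ S, c * Real.log n ≤ d n) (t : ℕ → ℕ) (ht : IsTStar (nToInfinityIn S) d t) :
    HoldsWhp (nToInfinityIn S) p (fun n G => (t n : ℕ∞) ≤ G.ediam) ∧
    (CaseOne (nToInfinityIn S) d t →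
      HoldsWhp (nToInfinityIn S) p (fun n G => G.ediam ≤ (t n : ℕ∞) + 3)) ∧
    (CaseTwo (nToInfinityIn S) d t →
      HoldsWhp (nToInfinityIn S) p (fun n G => G.ediam ≤ (t n : ℕ∞) + 2)) ∧
    (CaseOne (nToInfinityIn S) d t ∨ CaseTwo (nToInfinityIn S) d t →
      HoldsWhp (nToInfinityIn S) p
        (fun n G => G.ediam ∈
          ({(t n : ℕ∞), (t n : ℕ∞) + 1, (t n : ℕ∞) + 2, (t n : ℕ∞) + 3} : Set ℕ∞))) := by
  have h0 := holdsWhp_le_ediam hp hc hd ht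
  refine ⟨h0, holdsWhp_ediam_le_caseOne hp hc hd ht, holdsWhp_ediam_le_caseTwo hp hc hd ht,
    fun h => ?_⟩
  have h3 : HoldsWhp (nToInfinityIn S) p (fun n G => G.ediam ≤ (t n : ℕ∞) + 3) := by
    rcases h with h | h
    · exact holdsWhp_ediam_le_caseOne hp hc hd ht h
    · exact HoldsWhp.mono (holdsWhp_ediam_le_caseTwo hp hc hd ht h) fun n G hG =>
        hG.trans (add_le_add le_rfl (by norm_num))
  exact HoldsWhp.mono (HoldsWhp.and h0 h3) fun n G hG => mem_window hG.1 hG.2
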